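/- Let $d\in\{2,3\}$ and let $\Omega\subset\mathbb R^d$ be a bounded domain with polygonal boundary (with $\Omega=\operatorname{int}\overline\Omega$, i.e. without slits), let $\tau_h$ be a finite (matching) simplicial triangulation of $\Omega$, and let $\mathcal T_H$ be a coarse partition of $\Omega$ such that every $T\in\mathcal T_H$ is the union of a nonempty set $\tau_h^T\subset\tau_h$, the sets $\tau_h^T$ forming a partition of $\tau_h$. The coarse faces are $E=\partial T\cap\partial S$ ($T\ne S$) and $E=\partial T\cap\partial\Omega$; $\mathcal F_H$ is the set of all of them, $\mathcal F_H^T$ those of $T$, and $\mathcal F_h^E$ is the set of fine faces that cover $E$. Every fine face $e$ has a fixed unit normal $n_e$, pointing from $t^-$ to $t^+$ if $e=\partial t^-\cap\partial t^+$, and outward if $e\subset\partial\Omega$; $n_E|_e=n_e$. Let $f\in L^2(\Omega)$, and for $\mu$ in a set $\mathcal P\subset\mathbb R^m$ let $\lambda_\mu$ be continuous on $\Omega$, with measurable values on $\partial\Omega$, and bounded above and below by positive constants on $\overline\Omega$; let $\kappa$ be a tensor field that equals a constant symmetric positive definite matrix $\kappa^t$ on each $t\in\tau_h$. Fix $\mu\in\mathcal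 P$. For piecewise polynomial $q$ put, on an interior face $e$, $[\![q]\!]=q^--q^+$, $\{(\lambda_\mu\kappa\nabla_hq)\cdot n_e\}=\sum_{\pm}\omega_e^\pm(\lambda_\mu\kappa^\pm\nabla q^\pm)\cdot n_e$ with $\delta^\pm=n_e\cdot\kappa^\pm n_e$, $\omega_e^\pm=\delta^\mp/(\delta^-+\delta^+)$, and $\gamma_e=\alpha_e h_e^{-1}\delta^-\delta^+/(\delta^-+\delta^+)$; on a boundary face $[\![q]\!]=q$, the weight is $1$ and $\gamma_e=\alpha_eh_e^{-1}\,n_e\cdot\kappa n_e$. Here $\alpha_e>0$ are given numbers, $h_e=\operatorname{diam}e$, and $\sigma_E|_e=\lambda_\mu\gamma_e$. For $k\ge1$ and $T\in\mathcal T_H$ let $V_h^{k,T}$ be linear spaces of functions on $T$ that are polynomial of degree $\le k$ on each $t\in\tau_h^T$, with $V_h^{j,T}\subset V_h^{k,T}$ for $j\le k$; let $V_h^k(\mathcal T_H)=\bigoplus_TV_h^{k,T}$. Let $b_h^T$ (which may depend on $\mu$) be arbitrary bilinear forms on the piecewise polynomial functions on $\tau_h^T$, and $$b_h(p,q)=\sum_{T}b_h^T(p,q)+\sum_{E\in\mathcal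 F_H}\sum_{e\in\mathcal F_h^E}\int_e\Big(-\{(\lambda_\mu\kappa\nabla_hq)\cdot n_e\}[\![p]\!]-\big(\{(\lambda_\mu\kappa\nabla_hp)\cdot n_e\}-\sigma_E[\![p]\!]\big)[\![q]\!]\Big).$$ Fix integers $k\ge1$ and $k-1\le l\le k$. Let $p_*$ be either (i) a multi-scale SWIPDG approximation, i.e. $p_*\in V_h^1(\mathcal T_H)$ and $b_h(p_*,q)=\int_\Omega fq$ for all $q\in V_h^1(\mathcal T_H)$, where the constant function $1$ lies in $V_h^{1,T}$ for all $T\in\mathcal T_H$; or (ii) an LRBMS approximation, i.e., for linear subspaces $V_{\rm red}^T\subset V_h^{k,T}$, $p_*\in\bigoplus_TV_{\rm red}^T$ and $b_h(p_*,q)=\int_\Omega fq$ for all $q\in\bigoplus_TV_{\rm red}^T$, where $1\in V_{\rm red}^T$ for all $T\in\mathcal T_H$. Let $u_h\in RTN_h^l(\tau_h)=\{v\in H_{\rm div}(\Omega): v|_t\in[\mathbb P_l(t)]^d+x\,\mathbb P_l(t)\ \forall t\in\tau_h\}$ be a diffusive flux reconstruction of $p_*$, i.e. for all $T\in\mathcal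 T_H$ $$(u_h\cdot n_E,q)_{L^2,e}=\big(-\{(\lambda_\mu\kappa\nabla_hp_*)\cdot n_E\}+\sigma_E[\![p_*]\!],q\big)_{L^2,e}\quad\forall q\in\mathbb P_l(e),\ e\in\mathcal F_h^E,\ E\in\mathcal F_H^T,$$ $$(u_h,\nabla_hq)_{L^2,T}=-b_h^T(p_*,q)+\sum_{E\in\mathcal F_H^T}\big(\omega_E^T(\lambda_\mu\kappa|_T\nabla_hq|_T)\cdot n_E,[\![p_*]\!]\big)_{L^2,E}$$ for all $q\in V_h^{k,T}$ with $\nabla q|_t\in[\mathbb P_{l-1}(t)]^d$ for all $t\in\tau_h^T$ (with $\mathbb P_{-1}=\{0\}$), where $\omega_E^T$ is the weight of the side of $T$. Then $\int_T\nabla\cdot u_h=\int_Tf$ for every $T\in\mathcal T_H$. -/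

import Mathlib

open MeasureTheory
open scoped BigOperators ENNReal

noncomputable section

namespace LRBMS

open Classical

/-- The ambient Euclidean space `ℝ^d`. -/
abbrev Pt (d : ℕ) : Type := EuclideanSpace ℝ (Fin d)

/-- Real polynomials in `d` variables. -/
abbrev RPoly (d : ℕ) : Type := MvPolynomial (Fin d) ℝ

/-- The value of a polynomial at a point. -/
def ev {d : ℕ} (q : RPoly d) (x : Pt d) : ℝ := MvPolynomial.eval (fun i => x i) q

/-! ### Fine triangulation, coarse partition, faces -/

/-- A (matching) simplicial triangulation of a bounded polygonal domain `Ω ⊆ ℝ^d`: a finite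
simplicial complex all of whose faces are faces of `d`-simplices, which covers the closure of `Ω`.
The condition `interior_eq` says that `Ω` lies on one side of its boundary (no slits). -/
structure Triangulation (d : ℕ) (Ω : Set (Pt d)) extends Geometry.SimplicialComplex ℝ (Pt d) where
  finite : faces.Finite
  pure : ∀ e ∈ faces, ∃ t ∈ faces, e ⊆ t ∧ t.card = d + 1
  space_eq : (⋃ s ∈ faces, convexHull ℝ (s : Set (Pt d))) = closure Ω
  interior_eq : interior (closure Ω) = Ω

section Mesh

variable {d : ℕ} {Ω : Set (Pt d)} (τ : Triangulation d Ω)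

/-- The fine elements `t ∈ τ_h`, given by their sets of `d + 1` vertices. -/
abbrev Triangulation.Cell : Type := {t : Finset (Pt d) // t ∈ τ.faces ∧ t.card = d + 1}

/-- The fine faces `e ∈ F_h` (of codimension one), given by their sets of `d` vertices. -/
abbrev Triangulation.Facet : Type := {e : Finset (Pt d) // e ∈ τ.faces ∧ e.card = d}

instance : Fintype τ.Cell := (τ.finite.subset fun _ h => h.1).fintype

instance : Fintype τ.Facet := (τ.finite.subset fun _ h => h.1).fintype

variable {τ}

/-- The closed simplex of a fine element. -/
def cellSet (t : τ.Cell) : Set (Pt d) := convexHull ℝ (t.1 : Set (Pt d))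

/-- The closed simplex of a fine face. -/
def facetSet (e : τ.Facet) : Set (Pt d) := convexHull ℝ (e.1 : Set (Pt d))

/-- The fine elements that have `e` as a face: two for an interior face, one for a face on the
boundary of the domain. -/
def adj (e : τ.Facet) : Finset τ.Cell := Finset.univ.filter fun t => e.1 ⊆ t.1

/-- The integral over a fine face, with respect to the `(d-1)`-dimensional surface measure. -/
def faceInt (e : τ.Facet) (g : Pt d → ℝ) : ℝ :=
  ∫ x in facetSet e, g x ∂(Measure.euclideanHausdorffMeasure (d - 1))

variable (τ)

/-- A choice of orientation of the fine faces: an adjacent element `t⁻` and the unit normal `n_e`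
of `e` that points out of `t⁻` (hence into `t⁺`, or out of the domain if `e` is a boundary
face). -/
structure FaceOrientation where
  minus : τ.Facet → τ.Cell
  normal : τ.Facet → Pt d
  minus_mem : ∀ e, e.1 ⊆ (minus e).1
  norm_normal : ∀ e, ‖normal e‖ = 1
  normal_orth : ∀ e, ∀ x ∈ e.1, ∀ y ∈ e.1, inner ℝ (normal e) (x - y) = 0
  normal_out : ∀ e, ∀ x ∈ e.1, ∀ v ∈ (minus e).1, v ∉ e.1 → 0 < inner ℝ (normal e) (x - v)

/-- A coarse partition `T_H` of the domain, with elements indexed by `ι`, such that `τ_h` is nested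
in it: every coarse element is covered by the fine elements that belong to it. -/
structure CoarsePartition (ι : Type) where
  elem : τ.Cell → ι
  surj : Function.Surjective elem

variable {τ}

section Coarse

variable {ι : Type} [Fintype ι] (𝒯 : CoarsePartition τ ι)

/-- The fine elements `τ_h^T` that cover the coarse element `T`. -/
abbrev CoarsePartition.Sub (T : ι) : Type := {t : τ.Cell // 𝒯.elem t = T}

/-- The coarse element `T` as a subset of `ℝ^d`. -/
def CoarsePartition.region (T : ι) : Set (Pt d) := ⋃ t : 𝒯.Sub T, cellSet t.1

/-- The coarse face `E = ∂T ∩ ∂S` between coarse elements `T ≠ S`, given by the set `F_h^E` of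
the fine faces that cover it. -/
def CoarsePartition.interface (T S : ι) : Finset τ.Facet :=
  Finset.univ.filter fun e => ∃ t ∈ adj e, ∃ s ∈ adj e, 𝒯.elem t = T ∧ 𝒯.elem s = S

/-- The coarse face `E = ∂T ∩ ∂Ω`, given by the set `F_h^E` of the fine faces that cover it. -/
def CoarsePartition.boundaryFace (T : ι) : Finset τ.Facet :=
  Finset.univ.filter fun e => ∃ t, adj e = {t} ∧ 𝒯.elem t = T

/-- The set `F_H^T` of the coarse faces of the coarse element `T`. -/
def CoarsePartition.facesOf (T : ι) : Finset (Finset τ.Facet) :=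
  (insert (𝒯.boundaryFace T) ((Finset.univ.erase T).image (𝒯.interface T))).erase ∅

/-- The set `F_H` of all coarse faces. -/
def CoarsePartition.coarseFaces : Finset (Finset τ.Facet) := Finset.univ.biUnion 𝒯.facesOf

end Coarse

end Mesh

/-! ### Weak divergence -/

/-- `w` is the weak divergence in `Ω` of the vector field `v`: for all test functions
`φ ∈ C_c^∞(Ω)` one has `∫_Ω v · ∇φ = - ∫_Ω w φ`. -/
def IsWeakDiv {d : ℕ} (Ω : Set (Pt d)) (v : Pt d → Pt d) (w : Pt d → ℝ) : Prop :=
  ∀ φ : Pt d → ℝ, ContDiff ℝ ((⊤ : ℕ∞) : WithTop ℕ∞) φ → HasCompactSupport φ → tsupport φ ⊆ Ω →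
    ∫ x in Ω, fderiv ℝ φ x (v x) = - ∫ x in Ω, w x * φ x

/-- The space `H_div(Ω)` of square integrable vector fields with square integrable weak
divergence. -/
def MemHdiv {d : ℕ} (Ω : Set (Pt d)) (v : Pt d → Pt d) : Prop :=
  MemLp v 2 (volume.restrict Ω) ∧
    ∃ w : Pt d → ℝ, MemLp w 2 (volume.restrict Ω) ∧ IsWeakDiv Ω v w

/-! ### Data of the problem -/

section Data

variable {d : ℕ} {Ω : Set (Pt d)} (τ : Triangulation d Ω)

/-- The coefficients: for every parameter `μ ∈ P` the scalar function `λ_μ`, continuous on `Ω`,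
measurable and bounded above and below
(its values on `∂Ω` are used on boundary faces only), and the symmetric positive definite tensor
`κ`, constant on each fine element. -/
structure Coefficients {m : ℕ} (P : Set (EuclideanSpace ℝ (Fin m))) where
  lam : P → Pt d → ℝ
  kappa : τ.Cell → Matrix (Fin d) (Fin d) ℝ
  lam_meas : ∀ μ, Measurable (lam μ)
  lam_cont : ∀ μ, ContinuousOn (lam μ) Ω
  lam_bounds : ∀ μ, ∃ c C : ℝ, 0 < c ∧ ∀ x ∈ closure Ω, c ≤ lam μ x ∧ lam μ x ≤ C
  kappa_posDef : ∀ t, (kappa t).PosDef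

variable {τ} {ι : Type} [Fintype ι]

/-- Piecewise polynomial functions on `τ_h`. They are two-valued on interior fine faces; since
simplices have nonempty interior, a polynomial function on `t` is the same as a polynomial. -/
abbrev Triangulation.Broken (τ : Triangulation d Ω) : Type := τ.Cell → RPoly d

/-- Piecewise polynomial functions on the fine elements of one coarse element `T`. -/
abbrev CoarsePartition.LocalBroken (𝒯 : CoarsePartition τ ι) (T : ι) : Type := 𝒯.Sub T → RPoly d

/-- The restriction of a piecewise polynomial function to a coarse element. -/
def CoarsePartition.res (𝒯 : CoarsePartition τ ι) (T : ι) (q : τ.Broken) : 𝒯.LocalBroken T :=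
  fun t => q t.1

/-- The local approximation spaces `V_h^{k,T}`, of order `k = 1, 2, …`: linear spaces of functions
on `T` that are polynomials of degree at most `k` on each fine element, nested with respect to the
order. -/
structure LocalSpaces (𝒯 : CoarsePartition τ ι) where
  V : ℕ → (T : ι) → Submodule ℝ (𝒯.LocalBroken T)
  degree_le : ∀ k, 1 ≤ k → ∀ T, ∀ q ∈ V k T, ∀ t, (q t).totalDegree ≤ k
  mono : ∀ j k, 1 ≤ j → j ≤ k → ∀ T, V j T ≤ V k T

/-- Local bilinear forms `b_h^T`, for every parameter. Their choice is left free: any local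
discretization of `∫_T (λ κ ∇_h p) · ∇_h q` is allowed. -/
abbrev LocalForms {m : ℕ} (P : Set (EuclideanSpace ℝ (Fin m))) (𝒯 : CoarsePartition τ ι) : Type :=
  P → (T : ι) → LinearMap.BilinForm ℝ (𝒯.LocalBroken T)

end Data

/-! ### Jumps, weighted averages, penalty -/

section Traces

variable {d : ℕ} {Ω : Set (Pt d)} {τ : Triangulation d Ω} (o : FaceOrientation τ)
  {m : ℕ} {P : Set (EuclideanSpace ℝ (Fin m))} (c : Coefficients τ P) (μ : P)

/-- The jump across a fine face: `q⁻ - q⁺` on an interior face, `q` on a boundary face. -/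
def jump (e : τ.Facet) (q : τ.Broken) (x : Pt d) : ℝ :=
  ∑ t ∈ adj e, (if t = o.minus e then 1 else -1) * ev (q t) x

/-- `δ_{e,t} = n_e · κ^t n_e`. -/
def delta (e : τ.Facet) (t : τ.Cell) : ℝ :=
  (fun i => o.normal e i) ⬝ᵥ ((c.kappa t).mulVec fun i => o.normal e i)

/-- The SWIP weights: on an interior face, the weight of a side is the value of `δ_e` on the other
side divided by the sum of the two; the weight on a boundary face is one. -/
def weight (e : τ.Facet) (t : τ.Cell) : ℝ :=
  if adj e = {t} then 1
  else (∑ s ∈ (adj e).erase t, delta o c e s) / ∑ s ∈ adj e, delta o c e s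

/-- The trace on `e` from `t` of `(λ κ ∇q) · n_e`. -/
def normalFlux (e : τ.Facet) (t : τ.Cell) (q : RPoly d) (x : Pt d) : ℝ :=
  c.lam μ x *
    (((c.kappa t).mulVec fun i => ev (MvPolynomial.pderiv i q) x) ⬝ᵥ fun i => o.normal e i)

/-- The weighted average `{(λ κ ∇_h q) · n_e}`. -/
def meanFlux (e : τ.Facet) (q : τ.Broken) (x : Pt d) : ℝ :=
  ∑ t ∈ adj e, weight o c e t * normalFlux o c μ e t (q t) x

/-- The penalty coefficient `γ_e = α_e γ_{κ,e} / h_e`, where `γ_{κ,e}` is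
`δ⁻ δ⁺ / (δ⁻ + δ⁺)` on interior faces and `δ` on boundary faces. -/
def gammaPen (α : τ.Facet → ℝ) (e : τ.Facet) : ℝ :=
  α e * (if (adj e).card = 1 then ∑ t ∈ adj e, delta o c e t
    else (∏ t ∈ adj e, delta o c e t) / ∑ t ∈ adj e, delta o c e t) / Metric.diam (facetSet e)

/-- The penalty parameter `σ_E = λ γ_e` on `e`. -/
def sigma (α : τ.Facet → ℝ) (e : τ.Facet) (x : Pt d) : ℝ := c.lam μ x * gammaPen o c α e

/-! ### The multi-scale SWIPDG form and its Galerkin approximations -/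

/-- The coupling form `b_h^E` on a coarse face `E`. -/
def coupling (α : τ.Facet → ℝ) (E : Finset τ.Facet) (p q : τ.Broken) : ℝ :=
  ∑ e ∈ E, faceInt e fun x =>
    - (meanFlux o c μ e q x * jump o e p x)
      - (meanFlux o c μ e p x - sigma o c μ α e x * jump o e p x) * jump o e q x

variable {ι : Type} [Fintype ι] {𝒯 : CoarsePartition τ ι} (b : LocalForms P 𝒯)

/-- The multi-scale SWIPDG bilinear form `b_h`. -/
def formBh (α : τ.Facet → ℝ) (p q : τ.Broken) : ℝ :=
  (∑ T, b μ T (𝒯.res T p) (𝒯.res T q)) + ∑ E ∈ 𝒯.coarseFaces, coupling o c μ α E p q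

/-- The linear form `l(q) = ∑_T ∫_T f q`. -/
def formL (𝒯 : CoarsePartition τ ι) (f : Pt d → ℝ) (q : τ.Broken) : ℝ :=
  ∑ T, ∑ t : 𝒯.Sub T, ∫ x in cellSet t.1, f x * ev (q t.1) x

/-- Membership in the broken space `⊕_T W^T`. -/
def MemBroken (W : (T : ι) → Submodule ℝ (𝒯.LocalBroken T)) (q : τ.Broken) : Prop :=
  ∀ T, 𝒯.res T q ∈ W T

/-- `p` is the Galerkin approximation in the broken space `⊕_T W^T`. -/
def IsGalerkin (α : τ.Facet → ℝ) (f : Pt d → ℝ)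
    (W : (T : ι) → Submodule ℝ (𝒯.LocalBroken T)) (p : τ.Broken) : Prop :=
  MemBroken W p ∧ ∀ q, MemBroken W q → formBh o c μ b α p q = formL 𝒯 f q

/-- `p` is a multi-scale DG approximation, in `V_h^1(T_H)`. -/
def IsMultiscaleDG (α : τ.Facet → ℝ) (f : Pt d → ℝ) (S : LocalSpaces 𝒯) (p : τ.Broken) : Prop :=
  IsGalerkin o c μ b α f (S.V 1) p

/-- `p` is an LRBMS approximation with local reduced spaces `V_red^T ⊆ V_h^{k,T}`. -/
def IsLRBMS (α : τ.Facet → ℝ) (f : Pt d → ℝ) (S : LocalSpaces 𝒯) (k : ℕ)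
    (Vred : (T : ι) → Submodule ℝ (𝒯.LocalBroken T)) (p : τ.Broken) : Prop :=
  (∀ T, Vred T ≤ S.V k T) ∧ IsGalerkin o c μ b α f Vred p

/-! ### Raviart-Thomas-Nédélec space and diffusive flux reconstruction -/

/-- `RTN^l(t) = [P_l]^d + x P_l`. -/
def IsRTNLocal (l : ℕ) (v : Fin d → RPoly d) : Prop :=
  ∃ (a : Fin d → RPoly d) (r : RPoly d), (∀ i, (a i).totalDegree ≤ l) ∧ r.totalDegree ≤ l ∧
    ∀ i, v i = a i + MvPolynomial.X i * r

/-- The vector field on `ℝ^d` defined by a piecewise polynomial vector field (with value zero on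
the null set of the fine faces and outside the domain). -/
def field (u : τ.Cell → Fin d → RPoly d) (x : Pt d) : Pt d :=
  ∑ t : τ.Cell, (interior (cellSet t)).indicator (fun y => WithLp.toLp 2 fun i => ev (u t i) y) x

/-- `RTN^l_h(τ_h)`. -/
def MemRTN (l : ℕ) (u : τ.Cell → Fin d → RPoly d) : Prop :=
  MemHdiv Ω (field u) ∧ ∀ t, IsRTNLocal l (u t)

/-- The trace of `u · n_e` on `e` from `t`; for `u` in `H_div` it does not depend on `t`. -/
def normalTrace (u : τ.Cell → Fin d → RPoly d) (e : τ.Facet) (t : τ.Cell) (x : Pt d) : ℝ :=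
  ∑ i, ev (u t i) x * o.normal e i

/-- `q ∈ P_{l-1}`, with `P_{-1} = {0}`. -/
def DegLT (l : ℕ) (q : RPoly d) : Prop := q = 0 ∨ q.totalDegree < l

/-- `u ∈ RTN^l_h(τ_h)` is a diffusive flux reconstruction `u_h[p]` of `p`. The innermost sum over
`t` in the last condition has exactly one summand, and the weight is that of the side of `T`. -/
structure IsFluxReconstruction (α : τ.Facet → ℝ) (S : LocalSpaces 𝒯) (k l : ℕ) (p : τ.Broken)
    (u : τ.Cell → Fin d → RPoly d) : Prop where
  mem : MemRTN l u
  face : ∀ T, ∀ E ∈ 𝒯.facesOf T, ∀ e ∈ E, ∀ t ∈ adj e, 𝒯.elem t = T →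
    ∀ q : RPoly d, q.totalDegree ≤ l →
      faceInt e (fun x => normalTrace o u e t x * ev q x) =
        faceInt e (fun x =>
          (- meanFlux o c μ e p x + sigma o c μ α e x * jump o e p x) * ev q x)
  volume : ∀ T, ∀ q ∈ S.V k T, (∀ t i, DegLT l (MvPolynomial.pderiv i (q t))) →
    ∑ t : 𝒯.Sub T, ∫ x in cellSet t.1, ∑ i, ev (u t.1 i) x * ev (MvPolynomial.pderiv i (q t)) x =
      - b μ T (𝒯.res T p) q +
        ∑ E ∈ 𝒯.facesOf T, ∑ e ∈ E, ∑ t : 𝒯.Sub T, if t.1 ∈ adj e then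
          faceInt e fun x => weight o c e t.1 * normalFlux o c μ e t.1 (q t) x * jump o e p x
        else 0

/-- The local conservation property `(∇·v, 1)_T = (f, 1)_T` for all coarse elements `T`, for
`v ∈ H_div(Ω)` (the weak divergence `w` is unique up to null sets). -/
def LocallyConservative (𝒯 : CoarsePartition τ ι) (f : Pt d → ℝ) (v : Pt d → Pt d) : Prop :=
  MemHdiv Ω v ∧ ∀ w : Pt d → ℝ, MemLp w 2 (volume.restrict Ω) → IsWeakDiv Ω v w →
    ∀ T, ∫ x in 𝒯.region T, w x = ∫ x in 𝒯.region T, f x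

end Traces

end LRBMS

end

open LRBMS

/-!
The idea is to test with constants. Let `q` be the indicator function of a coarse element `T`.
Since the local space contains `1` and `∇_h q = 0`, the Galerkin equation for `q` says that
`b_h^T(p, 1)` plus the total numerical flux of `p` through `∂T` equals `∫_T f`
(`formBh_elemIndicator`, `formL_elemIndicator`). The volume condition on the reconstruction, for
the function `1`, gives `b_h^T(p, 1) = 0` (`IsFluxReconstruction.localForm_one`). The face
condition, for the polynomial `1`, says that the flux of `u` through a fine face on `∂T` is the
numerical flux of `p` (`IsFluxReconstruction.faceInt_normalTrace`). So `∫_T f` is the flux of `u`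
through `∂T`, and what is left is the divergence theorem `∫_T ∇ · u = ∫_{∂T} u · n` for the
piecewise polynomial field `u`, whose divergence is only known to exist weakly.

That theorem is reduced to a single simplex. On a simplex, the derivative of a scalar function
along an edge `a - b` is integrated by Fubini and the fundamental theorem of calculus in that
direction, which yields the difference of integrals over the two facets that do not contain the
edge; edges span all directions (`IsBary.setIntegral_fderiv_eq`). Testing the weak divergence with
functions supported inside one fine element shows that it is the elementwise divergence
(`weakDiv_ae_eq`); testing with functions supported near the relative interior of an interior fine
face shows that the normal traces from its two sides agree (`faceInt_normalTrace_eq`). Both use the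
fundamental lemma of the calculus of variations, the second time for the surface measure of the
face. Hence the contributions of fine faces interior to `T` cancel. The two sides of such a face
carry opposite signs because two simplices of a complex that share a facet lie on opposite sides of
it (`bary_apex_neg`).
-/

open MeasureTheory
open scoped BigOperators ENNReal

noncomputable section

namespace LRBMS

open Classical Module

/-! ### Surface measure on a hyperplane in linear coordinates -/

/-- The surface measure on a hyperplane with unit normal `ν`, in the linear coordinates given by
tangent vectors `a k` that form a basis of the hyperplane: it is a constant `c` times Lebesgue
measure (uniqueness of Haar measure). With the same `c`, Lebesgue measure of the whole space in
oblique coordinates along `w` and the `a k` has the density `c |ν · w|`; thus no determinant ever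
has to be computed. -/
theorem exists_surface_measure {n : ℕ} {κ : Type} [Fintype κ] (hκ : Fintype.card κ = n)
    (ν : Pt (n + 1)) (hν : ‖ν‖ = 1) (a : κ → Pt (n + 1)) (ha : LinearIndependent ℝ a)
    (horth : ∀ k, inner ℝ ν (a k) = 0) :
    ∃ c : ℝ≥0∞, c ≠ ∞ ∧
      (∀ x₀ : Pt (n + 1),
        (Measure.euclideanHausdorffMeasure n).restrict {x : Pt (n + 1) | inner ℝ ν (x - x₀) = 0} =
          c • (volume : Measure (κ → ℝ)).map fun y => x₀ + ∑ k, y k • a k) ∧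
      ∀ x₀ w : Pt (n + 1), inner ℝ ν w ≠ 0 →
        (volume : Measure (Pt (n + 1))) = (c * ENNReal.ofReal |inner ℝ ν w|) •
          (volume : Measure (ℝ × (κ → ℝ))).map fun p => x₀ + p.1 • w + ∑ k, p.2 k • a k := by
  set S : Submodule ℝ (Pt (n + 1)) := Submodule.span ℝ {ν}
  have hν0 : ν ≠ 0 := by rintro rfl; simp at hν
  have hfin : finrank ℝ Sᗮ = n := by
    have h1 := S.finrank_add_finrank_orthogonal
    rw [finrank_span_singleton hν0] at h1
    simp at h1; omega
  have hmem : ∀ x : Pt (n + 1), x ∈ Sᗮ ↔ inner ℝ ν x = 0 := fun x =>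
    Submodule.mem_orthogonal_singleton_iff_inner_right
  let a' : κ → Sᗮ := fun k => ⟨a k, (hmem _).2 (horth k)⟩
  have ha' : LinearIndependent ℝ a' := by
    apply LinearIndependent.of_comp Sᗮ.subtype
    exact ha
  let B : Basis κ ℝ Sᗮ := basisOfLinearIndependentOfCardEqFinrank' a' ha' (by rw [hκ, hfin])
  let L : (κ → ℝ) ≃L[ℝ] Sᗮ := B.equivFun.symm.toContinuousLinearEquiv
  have hL : ∀ y, ((L y : Sᗮ) : Pt (n + 1)) = ∑ k, y k • a k := by
    intro y
    simp [L, B, Basis.equivFun_symm_apply, a']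
  have : ((volume : Measure (κ → ℝ)).map L).IsAddHaarMeasure := L.isAddHaarMeasure_map _
  obtain ⟨c, hc⟩ : ∃ c : ℝ≥0∞, c ≠ ∞ ∧
      (volume : Measure Sᗮ) = c • (volume : Measure (κ → ℝ)).map L :=
    ⟨_, ENNReal.coe_ne_top, Measure.isAddLeftInvariant_eq_smul _ _⟩
  have hLm : Measurable L := L.continuous.measurable
  refine ⟨c, hc.1, fun x₀ => ?_, fun x₀ w hw => ?_⟩
  · let f : Sᗮ → Pt (n + 1) := fun x => x₀ + x
    have hf : Isometry f := (isometry_add_left x₀).comp isometry_subtype_coe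
    have hr : Set.range f = {x : Pt (n + 1) | inner ℝ ν (x - x₀) = 0} := by
      ext x
      constructor
      · rintro ⟨y, rfl⟩
        simpa [f] using (hmem _).1 y.2
      · intro hx
        exact ⟨⟨x - x₀, (hmem _).2 hx⟩, by simp [f]⟩
    have h1 := hf.map_euclideanHausdorffMeasure (d := n)
    rw [hr] at h1
    rw [← h1]
    have h2 : (Measure.euclideanHausdorffMeasure n : Measure Sᗮ) = volume := by
      rw [← InnerProductSpace.euclideanHausdorffMeasure_eq_volume, hfin]
    rw [h2, hc.2, Measure.map_smul, Measure.map_map hf.continuous.measurable hLm]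
    congr 2
    ext1 y
    simp [f, hL]
  · let v' : S := ⟨ν, Submodule.mem_span_singleton_self ν⟩
    have hS : (volume : Measure S) = (volume : Measure ℝ).map (· • v') := by
      rw [volume_eq_of_finrank_eq_one (v := v') (finrank_span_singleton hν0)
        (by simpa [v'] using hν0)]
      have hv1 : ‖v'‖ₑ = 1 := by
        rw [← ofReal_norm]
        simp [v', hν]
      rw [hv1, one_smul]
    have h1 := ((S.measurePreserving_measurableEquivProd x₀).symm).map_eq
    rw [InnerProductSpace.euclideanHausdorffMeasure_eq_volume] at h1
    have hm1 : Measurable fun r : ℝ => r • v' := by fun_prop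
    have h2 : (volume : Measure (S × Sᗮ)) = c • ((volume : Measure (ℝ × (κ → ℝ))).map
        (Prod.map (fun r : ℝ => r • v') L)) := by
      rw [Measure.volume_eq_prod, hc.2, hS, Measure.prod_smul_right,
        Measure.map_prod_map _ _ hm1 hLm]
      rfl
    set α : ℝ := inner ℝ ν w
    obtain ⟨y₀, hy₀⟩ : ∃ y₀ : κ → ℝ, ((L y₀ : Sᗮ) : Pt (n + 1)) = w - α • ν := by
      refine ⟨L.symm ⟨w - α • ν, (hmem _).2 ?_⟩, by simp⟩
      rw [inner_sub_right, inner_smul_right, real_inner_self_eq_norm_sq, hν]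
      simp [α]
    let G : ℝ × (κ → ℝ) → Pt (n + 1) := fun p => x₀ + p.1 • ν + ∑ k, p.2 k • a k
    have hG : Measurable G := by fun_prop
    have h3 : (volume : Measure (Pt (n + 1))) =
        c • (volume : Measure (ℝ × (κ → ℝ))).map G := by
      rw [← h1, h2, Measure.map_smul, Measure.map_map (MeasurableEquiv.measurable _) (by fun_prop)]
      congr 2
      ext1 p
      simp only [G, Function.comp, Prod.map, Submodule.measurableEquivProd_symm_apply, hL, v',
        Submodule.coe_smul, vadd_eq_add]
      abel
    -- `w = α ν + L y₀`: oblique coordinates are orthogonal ones after a shear and a scaling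
    let T₁ : ℝ × (κ → ℝ) → ℝ × (κ → ℝ) := Prod.map (α * ·) id
    let T₂ : ℝ × (κ → ℝ) → ℝ × (κ → ℝ) := fun p => (p.1, p.2 + p.1 • y₀)
    have hT₁ : Measurable T₁ := by fun_prop
    have hT₂ : MeasurePreserving T₂ volume volume :=
      (MeasurePreserving.id volume).skew_product (g := fun r y => y + r • y₀) (by fun_prop)
        (Filter.Eventually.of_forall fun r => (measurePreserving_add_right volume _).map_eq)
    have h4 : (volume : Measure (ℝ × (κ → ℝ))).map T₁ = ENNReal.ofReal |α⁻¹| • volume := by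
      rw [Measure.volume_eq_prod, ← Measure.map_prod_map _ _ (by fun_prop) measurable_id,
        Real.map_volume_mul_left hw, Measure.map_id, Measure.prod_smul_left]
    have h5 : (fun p : ℝ × (κ → ℝ) => x₀ + p.1 • w + ∑ k, p.2 k • a k) = G ∘ T₁ ∘ T₂ := by
      ext1 p
      simp only [G, T₁, T₂, Function.comp, Prod.map, id, ← hL, map_add, map_smul,
        Submodule.coe_add, Submodule.coe_smul, hy₀, smul_sub, smul_smul, mul_comm]
      abel
    rw [h5, ← Measure.map_map hG (hT₁.comp hT₂.measurable),
      ← Measure.map_map hT₁ hT₂.measurable, hT₂.map_eq, h4, Measure.map_smul, smul_smul,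
      mul_assoc, ← ENNReal.ofReal_mul (abs_nonneg _), ← abs_mul, mul_inv_cancel₀ hw]
    simpa using h3

/-! ### Barycentric coordinates of a simplex -/

/-- `lam x`, for `x ∈ t`, are the barycentric coordinates of the full-dimensional simplex with
vertex set `t`, as affine functions on the whole space; `lam x` is unconstrained for `x ∉ t`. -/
structure IsBary {d : ℕ} (t : Finset (Pt d)) (lam : Pt d → Pt d →ᵃ[ℝ] ℝ) : Prop where
  apply_vertex : ∀ x ∈ t, ∀ y ∈ t, lam x y = if x = y then 1 else 0
  sum_eq_one : ∀ p, ∑ x ∈ t, lam x p = 1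
  sum_smul : ∀ p, ∑ x ∈ t, lam x p • x = p
  interior_eq : interior (convexHull ℝ (t : Set (Pt d))) = {p | ∀ x ∈ t, 0 < lam x p}

theorem exists_isBary {d : ℕ} {t : Finset (Pt d)} (ht : AffineIndependent ℝ ((↑) : t → Pt d))
    (hc : t.card = d + 1) : ∃ lam, IsBary t lam := by
  have hspan : affineSpan ℝ (Set.range ((↑) : t → Pt d)) = ⊤ := by
    rw [ht.affineSpan_eq_top_iff_card_eq_finrank_add_one]
    simpa using hc
  let B : AffineBasis t ℝ (Pt d) := ⟨(↑), ht, hspan⟩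
  have hB : ∀ x : t, B x = x := fun _ => rfl
  refine ⟨fun x => if h : x ∈ t then B.coord ⟨x, h⟩ else 0, ?_, ?_, ?_, ?_⟩
  · intro x hx y hy
    have := B.coord_apply ⟨x, hx⟩ ⟨y, hy⟩
    rw [hB] at this
    simp only [hx, dif_pos, this, Subtype.mk.injEq]
  · intro p
    rw [← Finset.sum_attach, ← B.sum_coord_apply_eq_one p]
    simp
  · intro p
    rw [← Finset.sum_attach]
    conv_rhs => rw [← B.linear_combination_coord_eq_self p]
    simp [hB]
  · have := B.interior_convexHull
    rw [show Set.range B = (t : Set (Pt d)) by ext; simp [hB]] at this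
    rw [this]
    ext p
    simp only [Set.mem_ofPred_eq, Subtype.forall]
    refine forall₂_congr fun x hx => ?_
    simp [hx]

namespace IsBary

variable {d : ℕ} {t : Finset (Pt d)} {lam : Pt d → Pt d →ᵃ[ℝ] ℝ} (h : IsBary t lam)
include h

theorem mem_convexHull_iff {s : Finset (Pt d)} (hs : s ⊆ t) (p : Pt d) :
    p ∈ convexHull ℝ (s : Set (Pt d)) ↔
      (∀ x ∈ t, 0 ≤ lam x p) ∧ ∀ x ∈ t, x ∉ s → lam x p = 0 := by
  constructor
  · intro hp
    have hconv : Convex ℝ {p | (∀ x ∈ t, 0 ≤ lam x p) ∧ ∀ x ∈ t, x ∉ s → lam x p = 0} := by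
      intro p hp q hq a b ha hb hab
      have key : ∀ x, lam x (a • p + b • q) = a * lam x p + b * lam x q := fun x => by
        simpa using Convex.combo_affine_apply (f := lam x) (x := p) (y := q) hab
      refine ⟨fun x hx => ?_, fun x hx hxs => ?_⟩
      · rw [key]
        have := hp.1 x hx
        have := hq.1 x hx
        positivity
      · rw [key, hp.2 x hx hxs, hq.2 x hx hxs]; simp
    refine convexHull_min ?_ hconv hp
    intro y hy
    refine ⟨fun x hx => ?_, fun x hx hxs => ?_⟩
    · rw [h.apply_vertex x hx y (hs hy)]; split_ifs <;> norm_num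
    · rw [h.apply_vertex x hx y (hs hy), if_neg]
      rintro rfl; exact hxs hy
  · rintro ⟨h0, h1⟩
    have e1 : ∑ x ∈ s, lam x p = 1 := by
      rw [← h.sum_eq_one p]
      exact Finset.sum_subset hs fun x hx hxs => h1 x hx hxs
    have e2 : ∑ x ∈ s, lam x p • x = p := by
      conv_rhs => rw [← h.sum_smul p]
      exact Finset.sum_subset hs fun x hx hxs => by rw [h1 x hx hxs, zero_smul]
    rw [← e2]
    exact (convex_convexHull ℝ _).sum_mem (fun x hx => h0 x (hs hx)) e1
      fun x hx => subset_convexHull ℝ _ hx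

theorem mem_convexHull_self_iff (p : Pt d) :
    p ∈ convexHull ℝ (t : Set (Pt d)) ↔ ∀ x ∈ t, 0 ≤ lam x p := by
  rw [h.mem_convexHull_iff subset_rfl]
  exact ⟨fun hp => hp.1, fun hp => ⟨hp, fun x hx hxs => absurd hx hxs⟩⟩

/-- A linear functional that is constant on the facet `s` opposite `v` is determined by the
barycentric coordinate at `v`. -/
theorem sub_eq_mul {s : Finset (Pt d)} {v : Pt d} (hv : v ∉ s) (hs : t = insert v s)
    {ν x₀ : Pt d} (hν : ∀ x ∈ s, inner ℝ ν (x₀ - x) = 0) (p : Pt d) :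
    inner ℝ ν (x₀ - p) = lam v p * inner ℝ ν (x₀ - v) := by
  have e : x₀ - p = ∑ x ∈ t, lam x p • (x₀ - x) := by
    simp only [smul_sub, Finset.sum_sub_distrib, ← Finset.sum_smul, h.sum_eq_one, h.sum_smul,
      one_smul]
  rw [e, inner_sum, hs, Finset.sum_insert hv, Finset.sum_eq_zero, add_zero, inner_smul_right]
  intro x hx
  rw [inner_smul_right, hν x hx, mul_zero]

end IsBary

theorem volume_convexHull_diff_interior {d : ℕ} (t : Finset (Pt d)) :
    volume (convexHull ℝ (t : Set (Pt d)) \ interior (convexHull ℝ (t : Set (Pt d)))) = 0 := by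
  refine measure_mono_null ?_ ((convex_convexHull ℝ (t : Set (Pt d))).addHaar_frontier volume)
  exact Set.sdiff_subset_sdiff_left subset_closure

theorem isCompact_convexHull {d : ℕ} (t : Finset (Pt d)) :
    IsCompact (convexHull ℝ (t : Set (Pt d))) := t.finite_toSet.isCompact_convexHull ℝ

/-! ### Fubini and the fundamental theorem of calculus along an edge -/

/-- The standard corner simplex `{y ≥ 0, ∑ y ≤ 1}` in `ℝ^κ`. -/
def stdCorner (κ : Type*) [Fintype κ] : Set (κ → ℝ) := {y | (∀ k, 0 ≤ y k) ∧ ∑ k, y k ≤ 1}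

theorem isClosed_stdCorner (κ : Type*) [Fintype κ] : IsClosed (stdCorner κ) := by
  have : stdCorner κ = (⋂ k, {y | 0 ≤ y k}) ∩ {y | ∑ k, y k ≤ 1} := by
    ext; simp [stdCorner]
  rw [this]
  refine (isClosed_iInter fun k => isClosed_le ?_ ?_).inter (isClosed_le ?_ ?_) <;> fun_prop

theorem stdCorner_subset (κ : Type*) [Fintype κ] : stdCorner κ ⊆ Set.Icc 0 1 := by
  intro y hy
  refine ⟨fun k => hy.1 k, fun k => ?_⟩
  exact (Finset.single_le_sum (fun k _ => hy.1 k) (Finset.mem_univ k)).trans hy.2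

theorem isCompact_stdCorner (κ : Type*) [Fintype κ] : IsCompact (stdCorner κ) :=
  isCompact_Icc.of_isClosed_subset (isClosed_stdCorner κ) (stdCorner_subset κ)

/-- The affine parametrization, over the standard corner simplex, of the simplex with vertices `b`
and `s`, sending the origin to `b`. -/
def facetParam {d : ℕ} (s : Finset (Pt d)) (b : Pt d) (y : s → ℝ) : Pt d :=
  b + ∑ k, y k • ((k : Pt d) - b)

theorem continuous_facetParam {d : ℕ} (s : Finset (Pt d)) (b : Pt d) :
    Continuous (facetParam s b) := by
  unfold facetParam; fun_prop

/-- The barycentric coordinates of a point in the oblique coordinates `(r, y)`. -/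
theorem IsBary.apply_prism {d : ℕ} {s : Finset (Pt d)} {a b : Pt d} (ha : a ∉ insert b s)
    (hb : b ∉ s) {lam : Pt d → Pt d →ᵃ[ℝ] ℝ} (h : IsBary (insert a (insert b s)) lam)
    (r : ℝ) (y : s → ℝ) :
    lam a (facetParam s b y + r • (a - b)) = r ∧
    lam b (facetParam s b y + r • (a - b)) = 1 - r - ∑ k, y k ∧
    ∀ k : s, lam k (facetParam s b y + r • (a - b)) = y k := by
  have key : ∀ x, lam x (facetParam s b y + r • (a - b)) =
      lam x b + ∑ k : s, y k * (lam x k - lam x b) + r * (lam x a - lam x b) := by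
    intro x
    have e : facetParam s b y + r • (a - b) =
        (∑ k, y k • ((k : Pt d) - b) + r • (a - b)) +ᵥ b := by
      rw [facetParam, vadd_eq_add]; abel
    rw [e, AffineMap.map_vadd, map_add, map_sum, vadd_eq_add]
    simp only [map_smul, smul_eq_mul]
    simp only [← vsub_eq_sub, AffineMap.linearMap_vsub]
    simp only [vsub_eq_sub]
    ring
  have hab : a ≠ b := by rintro rfl; simp at ha
  have has : a ∉ s := fun h => ha (Finset.mem_insert_of_mem h)
  have mk : ∀ k : s, (k : Pt d) ∈ insert a (insert b s) := fun k => by simp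
  have ma : a ∈ insert a (insert b s) := by simp
  have mb : b ∈ insert a (insert b s) := by simp
  have nak : ∀ k : s, a ≠ k := fun k hk => has (hk ▸ k.2)
  have nbk : ∀ k : s, b ≠ k := fun k hk => hb (hk ▸ k.2)
  refine ⟨?_, ?_, fun k => ?_⟩
  · rw [key]
    simp [h.apply_vertex a ma a ma, h.apply_vertex a ma b mb, hab,
      fun k : s => h.apply_vertex a ma k (mk k), nak]
  · rw [key]
    simp [h.apply_vertex b mb a ma, h.apply_vertex b mb b mb, hab.symm,
      fun k : s => h.apply_vertex b mb k (mk k), nbk]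
    ring
  · rw [key]
    simp only [h.apply_vertex k (mk k) a ma, h.apply_vertex k (mk k) b mb, (nak k).symm,
      (nbk k).symm, if_false, sub_zero, mul_zero, add_zero, zero_add,
      fun j : s => h.apply_vertex k (mk k) j (mk j)]
    simp

theorem IsBary.linearIndependent_edges {d : ℕ} {s : Finset (Pt d)} {a b : Pt d}
    (ha : a ∉ insert b s)
    (hb : b ∉ s) {lam : Pt d → Pt d →ᵃ[ℝ] ℝ} (h : IsBary (insert a (insert b s)) lam) :
    LinearIndependent ℝ fun k : s => (k : Pt d) - b := by
  rw [Fintype.linearIndependent_iff]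
  intro y hy k
  have h1 := (h.apply_prism ha hb 0 y).2.2 k
  have h2 := (h.apply_prism ha hb 0 0).2.2 k
  simp only [facetParam, hy] at h1
  simp [facetParam] at h2 h1
  rw [← h1, h2]

theorem IsBary.prism_mem_iff {d : ℕ} {s : Finset (Pt d)} {a b : Pt d} (ha : a ∉ insert b s)
    (hb : b ∉ s) {lam : Pt d → Pt d →ᵃ[ℝ] ℝ} (h : IsBary (insert a (insert b s)) lam)
    (r : ℝ) (y : s → ℝ) :
    facetParam s b y + r • (a - b) ∈
        convexHull ℝ ((insert a (insert b s) : Finset (Pt d)) : Set (Pt d)) ↔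
      0 ≤ r ∧ (∀ k, 0 ≤ y k) ∧ r ≤ 1 - ∑ k, y k := by
  obtain ⟨e1, e2, e3⟩ := h.apply_prism ha hb r y
  rw [h.mem_convexHull_self_iff, Finset.forall_mem_insert, Finset.forall_mem_insert, e1, e2]
  refine and_congr_right fun hr => ?_
  rw [and_comm]
  refine and_congr ⟨fun H k => ?_, fun H k hk => ?_⟩ (by constructor <;> intro _ <;> linarith)
  · rw [← e3]; exact H k k.2
  · rw [e3 ⟨k, hk⟩]; exact H _

theorem IsBary.interior_nonempty {d : ℕ} {s : Finset (Pt d)} {a b : Pt d} (ha : a ∉ insert b s)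
    (hb : b ∉ s) {lam : Pt d → Pt d →ᵃ[ℝ] ℝ} (h : IsBary (insert a (insert b s)) lam) :
    (interior
      (convexHull ℝ ((insert a (insert b s) : Finset (Pt d)) : Set (Pt d)))).Nonempty := by
  have hN : (0 : ℝ) < s.card + 2 := by positivity
  obtain ⟨e1, e2, e3⟩ := h.apply_prism ha hb ((s.card + 2 : ℝ)⁻¹) fun _ => (s.card + 2 : ℝ)⁻¹
  refine ⟨facetParam s b (fun _ => (s.card + 2 : ℝ)⁻¹) + (s.card + 2 : ℝ)⁻¹ • (a - b), ?_⟩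
  rw [h.interior_eq]
  change ∀ x ∈ _, 0 < lam x _
  rw [Finset.forall_mem_insert, Finset.forall_mem_insert, e1, e2]
  refine ⟨by positivity, ?_, fun x hx => ?_⟩
  · simp only [Finset.sum_const, Finset.card_univ, Fintype.card_coe, nsmul_eq_mul]
    rw [show (1 : ℝ) - (s.card + 2 : ℝ)⁻¹ - s.card * (s.card + 2 : ℝ)⁻¹ = (s.card + 2 : ℝ)⁻¹ by
      field_simp; ring]
    positivity
  · rw [e3 ⟨x, hx⟩]; positivity

theorem IsBary.facetParam_mem_iff {d : ℕ} {s : Finset (Pt d)} {a b : Pt d} (ha : a ∉ insert b s)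
    (hb : b ∉ s) {lam : Pt d → Pt d →ᵃ[ℝ] ℝ} (h : IsBary (insert a (insert b s)) lam)
    (y : s → ℝ) :
    facetParam s b y ∈ convexHull ℝ ((insert b s : Finset (Pt d)) : Set (Pt d)) ↔
      y ∈ stdCorner s := by
  have e := (h.apply_prism ha hb 0 y).1
  have e' := h.prism_mem_iff ha hb 0 y
  simp only [zero_smul, add_zero] at e e'
  rw [h.mem_convexHull_self_iff] at e'
  rw [h.mem_convexHull_iff (Finset.subset_insert _ _), e']
  constructor
  · rintro ⟨⟨-, h1, h2⟩, -⟩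
    exact ⟨h1, by linarith⟩
  · rintro ⟨h1, h2⟩
    refine ⟨⟨le_rfl, h1, by linarith⟩, fun x hx hxs => ?_⟩
    rcases Finset.mem_insert.1 hx with rfl | hx
    · exact e
    · exact absurd hx hxs

/-- Integrals over the facet `insert b s` opposite `a`, and over the simplex
`insert a (insert b s)` fibred in the direction `a - b`, in the coordinates of `facetParam s b`.
Both involve the same constant `c`. -/
theorem IsBary.exists_integral_eq {n : ℕ} {s : Finset (Pt (n + 1))} (hs : s.card = n)
    {a b : Pt (n + 1)} (ha : a ∉ insert b s) (hb : b ∉ s)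
    {lam : Pt (n + 1) → Pt (n + 1) →ᵃ[ℝ] ℝ} (h : IsBary (insert a (insert b s)) lam)
    {ν : Pt (n + 1)} (hν : ‖ν‖ = 1) (horth : ∀ k ∈ s, inner ℝ ν (k - b) = 0)
    (hνa : inner ℝ ν (a - b) ≠ 0) :
    ∃ c : ℝ≥0∞, c ≠ ∞ ∧
      (Measure.euclideanHausdorffMeasure n).restrict
          (convexHull ℝ ((insert b s : Finset (Pt (n + 1))) : Set (Pt (n + 1)))) =
        c • ((volume : Measure (s → ℝ)).restrict (stdCorner s)).map (facetParam s b) ∧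
      ∀ G : Pt (n + 1) → ℝ, Continuous G →
        ∫ x in convexHull ℝ ((insert a (insert b s) : Finset (Pt (n + 1))) : Set (Pt (n + 1))), G x
          = c.toReal * |inner ℝ ν (a - b)| * ∫ y in stdCorner s,
            ∫ r in (0 : ℝ)..(1 - ∑ k, y k), G (facetParam s b y + r • (a - b)) := by
  obtain ⟨c, hc, h1, h2⟩ := exists_surface_measure (κ := s) (by simpa using hs) ν hν
    (fun k : s => (k : Pt (n + 1)) - b) (h.linearIndependent_edges ha hb)
    (fun k => horth k k.2)
  have hpm := (continuous_facetParam s b).measurable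
  refine ⟨c, hc, ?_, ?_⟩
  · have hsub : convexHull ℝ ((insert b s : Finset (Pt (n + 1))) : Set (Pt (n + 1))) ⊆
        {x : Pt (n + 1) | inner ℝ ν (x - b) = 0} := by
      refine convexHull_min ?_ ?_
      · intro x hx
        rcases Finset.mem_insert.1 (Finset.mem_coe.1 hx) with rfl | hx
        · simp
        · exact horth x hx
      · intro p hp q hq u v hu hv huv
        have : u • p + v • q - b = u • (p - b) + v • (q - b) := by
          rw [smul_sub, smul_sub, sub_add_sub_comm, ← add_smul, huv, one_smul]
        simp only [Set.mem_ofPred_eq] at hp hq ⊢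
        rw [this, inner_add_right, inner_smul_right, inner_smul_right, hp, hq]
        simp
    have hm := (isCompact_convexHull (insert b s)).isClosed.measurableSet
    have h3 := congrArg (fun m => m.restrict
      (convexHull ℝ ((insert b s : Finset (Pt (n + 1))) : Set (Pt (n + 1))))) (h1 b)
    simp only at h3
    rw [Measure.restrict_restrict hm, Set.inter_eq_left.2 hsub, Measure.restrict_smul,
      Measure.restrict_map (by exact hpm) hm] at h3
    rw [h3]
    congr 3
    ext y
    exact h.facetParam_mem_iff ha hb y
  · intro G hG
    let Ψ : ℝ × (s → ℝ) → Pt (n + 1) := fun p => facetParam s b p.2 + p.1 • (a - b)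
    have hΨ : Continuous Ψ := by
      have := continuous_facetParam s b
      fun_prop
    have hvol : (volume : Measure (Pt (n + 1))) = (c * ENNReal.ofReal |inner ℝ ν (a - b)|) •
        (volume : Measure (ℝ × (s → ℝ))).map Ψ := by
      rw [h2 b (a - b) hνa]
      congr 2
      ext1 p
      simp only [Ψ, facetParam]
      abel
    set D : Set (ℝ × (s → ℝ)) := Ψ ⁻¹'
      (convexHull ℝ ((insert a (insert b s) : Finset (Pt (n + 1))) : Set (Pt (n + 1))))
    have hD : ∀ p, p ∈ D ↔ 0 ≤ p.1 ∧ (∀ k, 0 ≤ p.2 k) ∧ p.1 ≤ 1 - ∑ k, p.2 k := fun p =>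
      h.prism_mem_iff ha hb p.1 p.2
    have hm := (isCompact_convexHull (insert a (insert b s))).isClosed.measurableSet
    have hDm : MeasurableSet D := hΨ.measurable hm
    have hDsub : D ⊆ Set.Icc 0 1 ×ˢ Set.Icc 0 1 := by
      rintro ⟨r, y⟩ hp
      obtain ⟨h1, h2, h3⟩ := (hD _).1 hp
      have h4 : 0 ≤ ∑ k, y k := Finset.sum_nonneg fun k _ => h2 k
      exact ⟨⟨h1, by simp only at h3; linarith⟩,
        stdCorner_subset s ⟨h2, by simp only at h1 h3 ⊢; linarith⟩⟩
    have hint : IntegrableOn (G ∘ Ψ) D volume :=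
      ((hG.comp hΨ).continuousOn.integrableOn_compact (isCompact_Icc.prod isCompact_Icc)).mono_set
        hDsub
    rw [hvol, Measure.restrict_smul, integral_smul_measure,
      setIntegral_map hm hG.aestronglyMeasurable hΨ.aemeasurable, ENNReal.toReal_mul,
      ENNReal.toReal_ofReal (abs_nonneg _), smul_eq_mul]
    congr 1
    rw [← integral_indicator hDm, Measure.volume_eq_prod, integral_prod_symm,
      ← integral_indicator (isClosed_stdCorner s).measurableSet]
    · refine integral_congr_ae (Filter.Eventually.of_forall fun y => ?_)
      simp only
      by_cases hy : y ∈ stdCorner s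
      · rw [Set.indicator_of_mem hy, intervalIntegral.integral_of_le (by linarith [hy.2]),
          ← integral_Icc_eq_integral_Ioc, ← integral_indicator measurableSet_Icc]
        congr 1
        ext1 r
        by_cases hr : r ∈ Set.Icc 0 (1 - ∑ k, y k)
        · rw [Set.indicator_of_mem hr, Set.indicator_of_mem ((hD _).2 ⟨hr.1, hy.1, hr.2⟩)]
        · rw [Set.indicator_of_notMem hr, Set.indicator_of_notMem]
          intro hp
          obtain ⟨h1, -, h3⟩ := (hD _).1 hp
          exact hr ⟨h1, h3⟩
      · rw [Set.indicator_of_notMem hy, ← integral_zero ℝ ℝ (μ := volume)]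
        congr 1
        ext1 r
        rw [Set.indicator_of_notMem]
        intro hp
        obtain ⟨h1, h2, h3⟩ := (hD _).1 hp
        exact hy ⟨h2, by simp only at h1 h3; linarith⟩
    · exact (integrable_indicator_iff hDm).2 hint

/-- The integral over a simplex of the derivative along an edge `a - b`, in terms of the facets
opposite `a` and `b`. -/
theorem IsBary.setIntegral_edge_deriv {n : ℕ} {s : Finset (Pt (n + 1))} (hs : s.card = n)
    {a b : Pt (n + 1)} (ha : a ∉ insert b s) (hb : b ∉ s)
    {lam : Pt (n + 1) → Pt (n + 1) →ᵃ[ℝ] ℝ} (h : IsBary (insert a (insert b s)) lam)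
    {νa νb : Pt (n + 1)} (hνa : ‖νa‖ = 1) (hνb : ‖νb‖ = 1)
    (horth_a : ∀ k ∈ s, inner ℝ νa (k - b) = 0) (horth_b : ∀ k ∈ s, inner ℝ νb (k - a) = 0)
    (hout_a : 0 < inner ℝ νa (b - a)) (hout_b : 0 < inner ℝ νb (a - b))
    {g : Pt (n + 1) → ℝ} (hg : ContDiff ℝ 1 g) :
    ∫ x in convexHull ℝ ((insert a (insert b s) : Finset (Pt (n + 1))) : Set (Pt (n + 1))),
        fderiv ℝ g x (a - b) =
      inner ℝ νa (a - b) * ∫ x in convexHull ℝ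
          ((insert b s : Finset (Pt (n + 1))) : Set (Pt (n + 1))),
        g x ∂(Measure.euclideanHausdorffMeasure n) +
      inner ℝ νb (a - b) * ∫ x in convexHull ℝ
          ((insert a s : Finset (Pt (n + 1))) : Set (Pt (n + 1))),
        g x ∂(Measure.euclideanHausdorffMeasure n) := by
  have has : a ∉ s := fun h => ha (Finset.mem_insert_of_mem h)
  have hba : b ∉ insert a s := by
    rw [Finset.mem_insert, not_or]
    exact ⟨fun e => ha (by rw [e]; simp), hb⟩
  have hab : inner ℝ νa (a - b) = - inner ℝ νa (b - a) := by rw [← inner_neg_right, neg_sub]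
  have hba' : inner ℝ νb (b - a) = - inner ℝ νb (a - b) := by rw [← inner_neg_right, neg_sub]
  obtain ⟨ca, -, ha1, ha2⟩ := h.exists_integral_eq hs ha hb hνa horth_a (by linarith)
  rw [Finset.insert_comm] at h
  obtain ⟨cb, -, hb1, hb2⟩ := h.exists_integral_eq hs hba has hνb horth_b (by linarith)
  rw [Finset.insert_comm] at h hb2
  -- the two prefactors agree, since both express the volume of the simplex
  have hc : ca.toReal * |inner ℝ νa (a - b)| = cb.toReal * |inner ℝ νb (b - a)| := by
    have h1 := ha2 (fun _ => 1) continuous_const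
    have h2 := hb2 (fun _ => 1) continuous_const
    rw [h1] at h2
    simp only [intervalIntegral.integral_const] at h2
    refine mul_right_cancel₀ ?_ h2
    intro h0
    simp only [intervalIntegral.integral_const] at h1
    rw [h0, mul_zero, setIntegral_const, smul_eq_mul, mul_one] at h1
    refine absurd h1 (ne_of_gt (ENNReal.toReal_pos ?_ (isCompact_convexHull _).measure_ne_top))
    refine ((h.interior_nonempty ha hb).mono ?_ |> isOpen_interior.measure_pos volume |>.trans_le
      (measure_mono interior_subset)).ne'
    exact subset_rfl
  have hg' : Continuous (fderiv ℝ g) := hg.continuous_fderiv one_ne_zero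
  have hg0 : Continuous g := hg.continuous
  have hI : ∀ z : Pt (n + 1), IntegrableOn (fun y => g (facetParam s z y)) (stdCorner s) volume :=
    fun z => (hg0.comp (continuous_facetParam s z)).continuousOn.integrableOn_compact
      (isCompact_stdCorner s)
  rw [ha2 _ (by fun_prop), ha1, hb1, integral_smul_measure, integral_smul_measure,
    integral_map (continuous_facetParam s b).aemeasurable hg0.aestronglyMeasurable,
    integral_map (continuous_facetParam s a).aemeasurable hg0.aestronglyMeasurable]
  -- the fibre over `y` runs from the facet opposite `a` to the facet opposite `b`
  have hFTC : ∀ y ∈ stdCorner s, ∫ r in (0 : ℝ)..(1 - ∑ k, y k),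
      fderiv ℝ g (facetParam s b y + r • (a - b)) (a - b) =
        g (facetParam s a y) - g (facetParam s b y) := by
    intro y hy
    have hd : ∀ r ∈ Set.uIcc (0 : ℝ) (1 - ∑ k, y k),
        HasDerivAt (fun r : ℝ => g (facetParam s b y + r • (a - b)))
          (fderiv ℝ g (facetParam s b y + r • (a - b)) (a - b)) r := by
      intro r _
      have h1 : HasDerivAt (fun r : ℝ => facetParam s b y + r • (a - b)) (a - b) r := by
        simpa using ((hasDerivAt_id r).smul_const (a - b)).const_add (facetParam s b y)
      exact ((hg.differentiable (by norm_num)).differentiableAt.hasFDerivAt).comp_hasDerivAt r h1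
    rw [intervalIntegral.integral_eq_sub_of_hasDerivAt hd
      (Continuous.intervalIntegrable (by fun_prop) _ _)]
    have e : facetParam s b y + (1 - ∑ k, y k) • (a - b) = facetParam s a y := by
      simp only [facetParam, smul_sub, Finset.sum_sub_distrib, sub_smul, one_smul,
        ← Finset.sum_smul]
      abel
    rw [e]
    simp
  rw [setIntegral_congr_fun (isClosed_stdCorner s).measurableSet hFTC,
    integral_sub (hI a) (hI b), mul_sub]
  rw [abs_of_neg (by linarith), abs_of_neg (by linarith)] at hc
  rw [abs_of_neg (by linarith)]
  simp only [smul_eq_mul]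
  rw [hba'] at hc
  linear_combination (∫ y in stdCorner s, g (facetParam s a y)) * hc

/-! ### The divergence theorem on a simplex -/

/-- `ν` is the unit outward normal of the simplex `t` on the facet opposite to its vertex `x`. -/
structure IsOutward {d : ℕ} (t : Finset (Pt d)) (x : Pt d) (ν : Pt d) : Prop where
  norm_eq : ‖ν‖ = 1
  orth : ∀ y ∈ t.erase x, ∀ z ∈ t.erase x, inner ℝ ν (y - z) = 0
  pos : ∀ y ∈ t.erase x, 0 < inner ℝ ν (y - x)

theorem insert_insert_erase {d : ℕ} {t : Finset (Pt d)} {a b : Pt d} (ha : a ∈ t) (hb : b ∈ t)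
    (hab : a ≠ b) :
    a ∉ insert b ((t.erase a).erase b) ∧ b ∉ (t.erase a).erase b ∧
      insert a (insert b ((t.erase a).erase b)) = t ∧ insert b ((t.erase a).erase b) = t.erase a ∧
      insert a ((t.erase a).erase b) = t.erase b := by
  have hb' : b ∈ t.erase a := Finset.mem_erase.2 ⟨hab.symm, hb⟩
  have ha' : a ∈ t.erase b := Finset.mem_erase.2 ⟨hab, ha⟩
  refine ⟨?_, by simp, ?_, Finset.insert_erase hb', ?_⟩
  · rw [Finset.insert_erase hb']; simp
  · rw [Finset.insert_erase hb', Finset.insert_erase ha]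
  · rw [Finset.erase_right_comm, Finset.insert_erase ha']

namespace IsBary

variable {n : ℕ} {t : Finset (Pt (n + 1))} {lam : Pt (n + 1) → Pt (n + 1) →ᵃ[ℝ] ℝ}

theorem vectorSpan_eq_top (h : IsBary t lam) (ht : t.Nonempty) :
    vectorSpan ℝ (t : Set (Pt (n + 1))) = ⊤ := by
  obtain ⟨b, hb⟩ := ht
  rw [eq_top_iff]
  intro v _
  have e : v = ∑ x ∈ t, lam x (b + v) • (x - b) := by
    simp only [smul_sub, Finset.sum_sub_distrib, ← Finset.sum_smul, h.sum_eq_one, h.sum_smul]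
    simp
  rw [e]
  exact Submodule.sum_mem _ fun x hx => Submodule.smul_mem _ _
    (vsub_mem_vectorSpan ℝ (Finset.mem_coe.2 hx) (Finset.mem_coe.2 hb))

/-- **Divergence theorem on a simplex**, for the constant direction `v`. Both sides are linear in
`v`, so it suffices to take for `v` an edge `a - b`. Only the facets opposite `a` and `b`
contribute then, since the other ones contain that edge. -/
theorem setIntegral_fderiv_eq (h : IsBary t lam) (hc : t.card = n + 2)
    {ν : Pt (n + 1) → Pt (n + 1)} (hν : ∀ x ∈ t, IsOutward t x (ν x))
    {g : Pt (n + 1) → ℝ} (hg : ContDiff ℝ 1 g) (v : Pt (n + 1)) :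
    ∫ x in convexHull ℝ (t : Set (Pt (n + 1))), fderiv ℝ g x v =
      ∑ x ∈ t, inner ℝ (ν x) v * ∫ y in convexHull ℝ (t.erase x : Set (Pt (n + 1))),
        g y ∂(Measure.euclideanHausdorffMeasure n) := by
  have hv : v ∈ vectorSpan ℝ (t : Set (Pt (n + 1))) := by
    rw [h.vectorSpan_eq_top (Finset.card_pos.1 (by omega))]; trivial
  have hg' : Continuous (fderiv ℝ g) := hg.continuous_fderiv one_ne_zero
  have hint : ∀ w, IntegrableOn (fun x => fderiv ℝ g x w) (convexHull ℝ (t : Set (Pt (n + 1)))) :=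
    fun w => (Continuous.continuousOn (by fun_prop)).integrableOn_compact (isCompact_convexHull t)
  rw [vectorSpan] at hv
  induction hv using Submodule.span_induction with
  | zero => simp
  | add u w _ _ hu hw =>
    simp only [map_add, inner_add_right, add_mul, Finset.sum_add_distrib]
    rw [integral_add (hint u) (hint w), hu, hw]
  | smul r u _ hu =>
    simp only [map_smul, inner_smul_right, smul_eq_mul, mul_assoc]
    rw [integral_const_mul, hu, Finset.mul_sum]
  | mem w hw =>
    obtain ⟨a, ha, b, hb, rfl⟩ := Set.mem_vsub.1 hw
    rw [Finset.mem_coe] at ha hb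
    rw [vsub_eq_sub]
    by_cases hab : a = b
    · subst hab; simp
    obtain ⟨i1, i2, i3, i4, i5⟩ := insert_insert_erase ha hb hab
    have hb' : b ∈ t.erase a := Finset.mem_erase.2 ⟨Ne.symm hab, hb⟩
    have ha' : a ∈ t.erase b := Finset.mem_erase.2 ⟨hab, ha⟩
    have hcard : ((t.erase a).erase b).card = n := by
      rw [Finset.card_erase_of_mem hb', Finset.card_erase_of_mem ha, hc]; omega
    have hs : ∀ k ∈ (t.erase a).erase b, k ∈ t.erase a ∧ k ∈ t.erase b := fun k hk =>
      ⟨Finset.mem_of_mem_erase hk, i5 ▸ Finset.mem_insert_of_mem hk⟩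
    have key := IsBary.setIntegral_edge_deriv (s := (t.erase a).erase b) hcard i1 i2
      (lam := lam) (i3.symm ▸ h) (hν a ha).norm_eq (hν b hb).norm_eq
      (fun k hk => (hν a ha).orth k (hs k hk).1 b hb')
      (fun k hk => (hν b hb).orth k (hs k hk).2 a ha')
      ((hν a ha).pos b hb') ((hν b hb).pos a ha') hg
    rw [i3, i4, i5] at key
    rw [key, ← Finset.add_sum_erase _ _ ha, ← Finset.add_sum_erase _ _ hb', Finset.sum_eq_zero]
    · simp
    · intro x hx
      have hxb := Finset.mem_erase.1 hx
      have hxa := Finset.mem_erase.1 hxb.2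
      rw [(hν x hxa.2).orth a (Finset.mem_erase.2 ⟨hxa.1.symm, ha⟩) b
        (Finset.mem_erase.2 ⟨hxb.1.symm, hb⟩), zero_mul]

/-- A facet of a simplex has finite surface measure, and its relative boundary is null for it. For
the coordinate at a vertex `b`, parametrizing from `b` turns the zero set into the hyperplane
`∑ y = 1`. -/
theorem facet_measure_ne_top_and_pos (h : IsBary t lam) (hc : t.card = n + 2) {a : Pt (n + 1)}
    (ha : a ∈ t) {ν : Pt (n + 1)} (hν : IsOutward t a ν) :
    Measure.euclideanHausdorffMeasure n (convexHull ℝ (t.erase a : Set (Pt (n + 1)))) ≠ ∞ ∧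
      ∀ b ∈ t.erase a, ∀ᵐ p ∂(Measure.euclideanHausdorffMeasure n).restrict
        (convexHull ℝ (t.erase a : Set (Pt (n + 1)))), 0 < lam b p := by
  have aux : ∀ b ∈ t.erase a, ∃ c : ℝ≥0∞, c ≠ ∞ ∧
      (Measure.euclideanHausdorffMeasure n).restrict
          (convexHull ℝ (t.erase a : Set (Pt (n + 1)))) =
        c • ((volume : Measure (((t.erase a).erase b : Finset _) → ℝ)).restrict
          (stdCorner _)).map (facetParam ((t.erase a).erase b) b) ∧
      ∀ y, lam b (facetParam ((t.erase a).erase b) b y) = 1 - ∑ k, y k := by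
    intro b hb'
    obtain ⟨hab, hb⟩ := Finset.mem_erase.1 hb'
    obtain ⟨i1, i2, i3, i4, i5⟩ := insert_insert_erase ha hb hab.symm
    have hcard : ((t.erase a).erase b).card = n := by
      rw [Finset.card_erase_of_mem hb', Finset.card_erase_of_mem ha, hc]; omega
    have h' : IsBary (insert a (insert b ((t.erase a).erase b))) lam := i3.symm ▸ h
    obtain ⟨c, hc, h1, -⟩ := h'.exists_integral_eq hcard i1 i2 hν.norm_eq
      (fun k hk => hν.orth k (Finset.mem_of_mem_erase hk) b hb')
      (by rw [← neg_sub, inner_neg_right]; exact (neg_neg_of_pos (hν.pos b hb')).ne)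
    rw [i4] at h1
    refine ⟨c, hc, h1, fun y => ?_⟩
    have := (h'.apply_prism i1 i2 0 y).2.1
    simpa using this
  refine ⟨?_, fun b hb => ?_⟩
  · obtain ⟨b, hb⟩ : (t.erase a).Nonempty := Finset.card_pos.1 (by
      rw [Finset.card_erase_of_mem ha]; omega)
    obtain ⟨c, hc, h1, -⟩ := aux b hb
    have h2 := congrArg (fun m => m Set.univ) h1
    simp only [Measure.restrict_apply_univ] at h2
    rw [h2, Measure.smul_apply, Measure.map_apply (continuous_facetParam _ _).measurable
      MeasurableSet.univ, Set.preimage_univ, Measure.restrict_apply_univ]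
    exact ENNReal.mul_ne_top hc (isCompact_stdCorner _).measure_ne_top
  · obtain ⟨c, hc, h1, h2⟩ := aux b hb
    rw [h1]
    refine Measure.ae_smul_measure ?_ c
    have hcont : Continuous (lam b) := (lam b).continuous_of_finiteDimensional
    rw [ae_map_iff (continuous_facetParam _ _).aemeasurable
      (isOpen_lt continuous_const hcont).measurableSet]
    simp only [h2]
    rw [ae_restrict_iff' (isClosed_stdCorner _).measurableSet]
    let ℓ : ((((t.erase a).erase b : Finset _)) → ℝ) →ₗ[ℝ] ℝ := ∑ k, LinearMap.proj k
    have hℓ : ∀ y, ℓ y = ∑ k, y k := fun y => by simp [ℓ]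
    have hnull : volume {y : (((t.erase a).erase b : Finset _)) → ℝ | ∑ k, y k = 1} = 0 := by
      by_cases hne : ∃ y₀, ℓ y₀ = 1
      · obtain ⟨y₀, hy₀⟩ := hne
        have := Measure.addHaar_affineSubspace volume (AffineSubspace.mk' y₀ (LinearMap.ker ℓ)) ?_
        · refine measure_mono_null ?_ this
          intro y hy
          rw [SetLike.mem_coe, AffineSubspace.mem_mk', LinearMap.mem_ker, vsub_eq_sub, map_sub, hy₀,
            hℓ, hy, sub_self]
        · intro htop
          have h3 := congrArg AffineSubspace.direction htop
          rw [AffineSubspace.direction_mk', AffineSubspace.direction_top] at h3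
          have : y₀ ∈ LinearMap.ker ℓ := h3 ▸ trivial
          rw [LinearMap.mem_ker, hy₀] at this
          exact one_ne_zero this
      · refine measure_mono_null (fun y hy => hne ⟨y, ?_⟩) (measure_empty (μ := volume))
        rw [hℓ]; exact hy
    filter_upwards [compl_mem_ae_iff.2 hnull] with y hy hyc
    have : ∑ k, y k ≠ 1 := hy
    have := lt_of_le_of_ne hyc.2 this
    linarith

end IsBary

/-! ### Fine elements around a fine face -/

section Mesh

variable {d : ℕ} {Ω : Set (Pt d)} {τ : Triangulation d Ω}

theorem Triangulation.exists_bary (t : τ.Cell) : ∃ lam, IsBary t.1 lam :=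
  exists_isBary (τ.indep t.2.1) t.2.2

/-- A choice of the barycentric coordinates of a fine element. -/
def bary (t : τ.Cell) : Pt d → Pt d →ᵃ[ℝ] ℝ := (Triangulation.exists_bary t).choose

theorem isBary_bary (t : τ.Cell) : IsBary t.1 (bary t) := (Triangulation.exists_bary t).choose_spec

theorem continuous_bary (t : τ.Cell) (x : Pt d) : Continuous (bary t x) :=
  (bary t x).continuous_of_finiteDimensional

/-- If a point of the fine element `t` with positive barycentric coordinates at the vertices in `s`
lies in a simplex `F` of the triangulation, then `F` contains `s`, because simplices meet in common
faces. -/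
theorem subset_of_bary_pos {t : τ.Cell} {F s : Finset (Pt d)} (hF : F ∈ τ.faces) (hs : s ⊆ t.1)
    {z : Pt d} (hzt : z ∈ cellSet t) (hzF : z ∈ convexHull ℝ (F : Set (Pt d)))
    (hpos : ∀ x ∈ s, 0 < bary t x z) : s ⊆ F := by
  intro x hx
  have h1 := τ.inter_subset_convexHull t.2.1 hF ⟨hzt, hzF⟩
  rw [← Finset.coe_inter, (isBary_bary t).mem_convexHull_iff Finset.inter_subset_left] at h1
  by_contra hxF
  exact (hpos x hx).ne' (h1.2 x (hs hx) fun h => hxF (Finset.mem_inter.1 h).2)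

theorem mem_interior_cellSet {t : τ.Cell} {z : Pt d} :
    z ∈ interior (cellSet t) ↔ ∀ x ∈ t.1, 0 < bary t x z := by
  rw [cellSet, (isBary_bary t).interior_eq]; rfl

theorem subset_of_mem_interior {t : τ.Cell} {F : Finset (Pt d)} (hF : F ∈ τ.faces)
    {z : Pt d} (hzt : z ∈ interior (cellSet t)) (hzF : z ∈ convexHull ℝ (F : Set (Pt d))) :
    t.1 ⊆ F :=
  subset_of_bary_pos hF subset_rfl (interior_subset hzt) hzF (mem_interior_cellSet.1 hzt)

theorem cell_eq_of_subset {t r : τ.Cell} (h : t.1 ⊆ r.1) : t = r :=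
  Subtype.ext (Finset.eq_of_subset_of_card_le h (by rw [t.2.2, r.2.2]))

theorem facet_eq_of_subset {e f : τ.Facet} (h : e.1 ⊆ f.1) : e = f :=
  Subtype.ext (Finset.eq_of_subset_of_card_le h (by rw [e.2.2, f.2.2]))

theorem cell_eq_of_mem_interior {t r : τ.Cell} {z : Pt d} (hzt : z ∈ interior (cellSet t))
    (hzr : z ∈ cellSet r) : t = r :=
  cell_eq_of_subset (subset_of_mem_interior r.2.1 hzt hzr)

theorem mem_adj {e : τ.Facet} {t : τ.Cell} : t ∈ adj e ↔ e.1 ⊆ t.1 := by simp [adj]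

theorem exists_apex {e : τ.Facet} {t : τ.Cell} (h : t ∈ adj e) :
    ∃ v, v ∉ e.1 ∧ t.1 = insert v e.1 := by
  obtain ⟨v, hv, h1⟩ := Finset.exists_eq_insert_iff.2 ⟨mem_adj.1 h, by rw [e.2.2, t.2.2]⟩
  exact ⟨v, hv, h1.symm⟩

theorem inter_eq_facet {e : τ.Facet} {t s : τ.Cell} (ht : t ∈ adj e) (hs : s ∈ adj e)
    (hts : t ≠ s) : t.1 ∩ s.1 = e.1 := by
  obtain ⟨v, hv, htv⟩ := exists_apex ht
  refine Finset.Subset.antisymm (fun x hx => ?_)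
    (Finset.subset_inter (mem_adj.1 ht) (mem_adj.1 hs))
  obtain ⟨h1, h2⟩ := Finset.mem_inter.1 hx
  rw [htv] at h1
  rcases Finset.mem_insert.1 h1 with rfl | h1
  · refine absurd (cell_eq_of_subset ?_) hts
    rw [htv]
    exact Finset.insert_subset h2 (mem_adj.1 hs)
  · exact h1

/-- Two fine elements `t ≠ s` with a common fine face `e` lie on opposite sides of it: the apex `w`
of `s` has a negative barycentric coordinate at the apex `v` of `t`. Otherwise the segment from the
barycentre of `e` to `w` would start inside both elements, whereas these meet in `e` only. -/
theorem bary_apex_neg {e : τ.Facet} (he : e.1.Nonempty) {t s : τ.Cell} (ht : t ∈ adj e)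
    (hs : s ∈ adj e)
    (hts : t ≠ s) {v w : Pt d} (hv : v ∉ e.1) (hw : w ∉ e.1) (htv : t.1 = insert v e.1)
    (hsw : s.1 = insert w e.1) : bary t v w < 0 := by
  by_contra! hneg
  have hd : (0 : ℝ) < e.1.card := by exact_mod_cast he.card_pos
  -- a point near the barycentre of `e`, displaced towards `w`
  let m : Pt d := ∑ x ∈ e.1, (e.1.card : ℝ)⁻¹ • x
  let p : ℝ → Pt d := fun ε => AffineMap.lineMap m w ε
  have hm : m ∈ convexHull ℝ (e.1 : Set (Pt d)) := by
    refine (convex_convexHull ℝ _).sum_mem (fun _ _ => by positivity) ?_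
      fun x hx => subset_convexHull ℝ _ hx
    rw [Finset.sum_const, nsmul_eq_mul, mul_inv_cancel₀ hd.ne']
  have hmt : ∀ x ∈ e.1, bary t x m = (e.1.card : ℝ)⁻¹ := by
    intro x hx
    have h1 : m = e.1.affineCombination ℝ id (fun _ => (e.1.card : ℝ)⁻¹) := by
      rw [e.1.affineCombination_eq_linear_combination]
      · rfl
      · rw [Finset.sum_const, nsmul_eq_mul, mul_inv_cancel₀ hd.ne']
    rw [h1, Finset.map_affineCombination, e.1.affineCombination_eq_linear_combination]
    · simp only [Function.comp, id, smul_eq_mul]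
      rw [Finset.sum_eq_single x]
      · rw [(isBary_bary t).apply_vertex x (mem_adj.1 ht hx) x (mem_adj.1 ht hx)]; simp
      · intro y hy hyx
        rw [(isBary_bary t).apply_vertex x (mem_adj.1 ht hx) y (mem_adj.1 ht hy),
          if_neg hyx.symm, mul_zero]
      · exact fun h => absurd hx h
    all_goals rw [Finset.sum_const, nsmul_eq_mul, mul_inv_cancel₀ hd.ne']
  have hev : ∀ᶠ ε in nhdsWithin (0 : ℝ) (Set.Ioi 0), ∀ x ∈ e.1, 0 < bary t x (p ε) := by
    refine (Filter.eventually_all_finset _).2 fun x hx => ?_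
    have hc : Continuous fun ε => bary t x (p ε) :=
      (continuous_bary t x).comp AffineMap.lineMap_continuous
    refine (hc.tendsto 0).eventually (lt_mem_nhds ?_) |>.filter_mono nhdsWithin_le_nhds
    simp only [p, AffineMap.lineMap_apply_zero, hmt x hx]
    positivity
  obtain ⟨ε, hε, hε0, hε1⟩ := (hev.and (Ioo_mem_nhdsGT (zero_lt_one' ℝ))).exists
  have hps : p ε ∈ convexHull ℝ (s.1 : Set (Pt d)) :=
    (convex_convexHull ℝ _).lineMap_mem (convexHull_mono (by exact_mod_cast mem_adj.1 hs) hm)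
      (subset_convexHull ℝ _ (by simp [hsw])) ⟨hε0.le, hε1.le⟩
  have hv0 : bary t v m = 0 :=
    (((isBary_bary t).mem_convexHull_iff (mem_adj.1 ht) m).1 hm).2 v (by simp [htv]) hv
  have hw0 : bary s w m = 0 :=
    (((isBary_bary s).mem_convexHull_iff (mem_adj.1 hs) m).1 hm).2 w (by simp [hsw]) hw
  have hpt : p ε ∈ convexHull ℝ (t.1 : Set (Pt d)) := by
    rw [(isBary_bary t).mem_convexHull_self_iff]
    intro x hx
    rw [htv] at hx
    rcases Finset.mem_insert.1 hx with rfl | hx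
    · simp only [p, AffineMap.apply_lineMap, hv0, AffineMap.lineMap_apply_ring', sub_zero, add_zero]
      positivity
    · exact (hε x hx).le
  have h1 := τ.inter_subset_convexHull t.2.1 s.2.1 ⟨hpt, hps⟩
  rw [← Finset.coe_inter, inter_eq_facet ht hs hts,
    (isBary_bary s).mem_convexHull_iff (mem_adj.1 hs)] at h1
  have h2 := h1.2 w (by simp [hsw]) hw
  simp only [p, AffineMap.apply_lineMap, hw0, AffineMap.lineMap_apply_ring', sub_zero, add_zero,
    (isBary_bary s).apply_vertex w (by simp [hsw] : w ∈ s.1) w (by simp [hsw]), if_true,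
    mul_one] at h2
  exact hε0.ne' h2

end Mesh

section Orientation

variable {n : ℕ} {Ω : Set (Pt (n + 1))} {τ : Triangulation (n + 1) Ω} (o : FaceOrientation τ)

theorem Triangulation.facet_nonempty (e : τ.Facet) : e.1.Nonempty :=
  Finset.card_pos.1 (by rw [e.2.2]; omega)

/-- The sign for which `sgn o e t • n_e` is the normal of `e` pointing out of `t`. -/
def sgn (e : τ.Facet) (t : τ.Cell) : ℝ := if t = o.minus e then 1 else -1

theorem minus_mem_adj (e : τ.Facet) : o.minus e ∈ adj e := mem_adj.2 (o.minus_mem e)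

variable {o}

theorem inner_normal_eq {e : τ.Facet} {t : τ.Cell} {v x : Pt (n + 1)} (hv : v ∉ e.1)
    (htv : t.1 = insert v e.1) (hx : x ∈ e.1) (p : Pt (n + 1)) :
    inner ℝ (o.normal e) (x - p) = bary t v p * inner ℝ (o.normal e) (x - v) :=
  (isBary_bary t).sub_eq_mul hv htv (fun y hy => o.normal_orth e x hx y hy) p

theorem inner_normal_neg {e : τ.Facet} {t : τ.Cell} (ht : t ∈ adj e) (hne : t ≠ o.minus e)
    {v x : Pt (n + 1)} (hv : v ∉ e.1) (htv : t.1 = insert v e.1) (hx : x ∈ e.1) :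
    inner ℝ (o.normal e) (x - v) < 0 := by
  obtain ⟨w, hw, hsw⟩ := exists_apex (minus_mem_adj o e)
  rw [inner_normal_eq hw hsw hx v]
  exact mul_neg_of_neg_of_pos
    (bary_apex_neg (Triangulation.facet_nonempty e) (minus_mem_adj o e) ht hne.symm hw hv hsw htv)
    (o.normal_out e x hx w (by simp [hsw]) hw)

theorem isOutward_sgn_smul_normal {e : τ.Facet} {t : τ.Cell} (ht : t ∈ adj e) {v : Pt (n + 1)}
    (hv : v ∉ e.1) (htv : t.1 = insert v e.1) : IsOutward t.1 v (sgn o e t • o.normal e) := by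
  have he : t.1.erase v = e.1 := by rw [htv, Finset.erase_insert hv]
  refine ⟨?_, ?_, ?_⟩
  · rw [norm_smul, o.norm_normal, sgn]; split_ifs <;> simp
  · intro y hy z hz
    rw [he] at hy hz
    rw [inner_smul_left, o.normal_orth e y hy z hz, mul_zero]
  · intro y hy
    rw [he] at hy
    rw [inner_smul_left, sgn]
    split_ifs with h
    · subst h
      simpa using o.normal_out e y hy v (by simp [htv]) hv
    · simpa using inner_normal_neg ht h hv htv hy

/-- Besides `t⁻`, at most one fine element has `e` as a face: all of these lie on the side into
which `n_e` points. -/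
theorem eq_of_ne_minus {e : τ.Facet} {t s : τ.Cell} (ht : t ∈ adj e) (hs : s ∈ adj e)
    (hne : t ≠ o.minus e) (hne' : s ≠ o.minus e) : t = s := by
  by_contra hts
  obtain ⟨x, hx⟩ := Triangulation.facet_nonempty e
  obtain ⟨v, hv, htv⟩ := exists_apex ht
  obtain ⟨w, hw, hsw⟩ := exists_apex hs
  have h1 := inner_normal_neg ht hne hv htv hx
  have h2 := inner_normal_neg hs hne' hw hsw hx
  rw [inner_normal_eq hv htv hx w] at h2
  exact absurd h2 (mul_pos_of_neg_of_neg
    (bary_apex_neg ⟨x, hx⟩ ht hs hts hv hw htv hsw) h1).not_gt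

theorem adj_eq_pair (o : FaceOrientation τ) {e : τ.Facet} {t s : τ.Cell} (ht : t ∈ adj e)
    (hs : s ∈ adj e) (hts : t ≠ s) : adj e = {t, s} := by
  ext r
  rw [Finset.mem_insert, Finset.mem_singleton]
  refine ⟨fun hr => ?_, by rintro (rfl | rfl) <;> assumption⟩
  by_contra! hne
  by_cases h1 : t = o.minus e
  · exact hne.2 (eq_of_ne_minus (o := o) hr hs (h1 ▸ hne.1) (h1 ▸ hts.symm))
  · by_cases h2 : s = o.minus e
    · exact hne.1 (eq_of_ne_minus (o := o) hr ht (h2 ▸ hne.2) h1)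
    · exact hts (eq_of_ne_minus (o := o) ht hs h1 h2)

theorem sgn_add_sgn {e : τ.Facet} {t s : τ.Cell} (ht : t ∈ adj e)
    (hs : s ∈ adj e) (hts : t ≠ s) : sgn o e t + sgn o e s = 0 := by
  have h := minus_mem_adj o e
  rw [adj_eq_pair o ht hs hts, Finset.mem_insert, Finset.mem_singleton] at h
  unfold sgn
  rcases h with h | h
  · rw [h, if_pos rfl, if_neg hts.symm]; norm_num
  · rw [h, if_pos rfl, if_neg hts]; norm_num

/-- Two fine elements that share the fine face `e` cover a neighbourhood of its relative
interior. -/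
theorem mem_union_of_bary_pos (o : FaceOrientation τ) {e : τ.Facet} {t s : τ.Cell} (ht : t ∈ adj e)
    (hs : s ∈ adj e) (hts : t ≠ s) {p : Pt (n + 1)} (hpt : ∀ x ∈ e.1, 0 < bary t x p)
    (hps : ∀ x ∈ e.1, 0 < bary s x p) : p ∈ cellSet t ∪ cellSet s := by
  obtain ⟨x, hx⟩ := Triangulation.facet_nonempty e
  obtain ⟨v, hv, htv⟩ := exists_apex ht
  obtain ⟨w, hw, hsw⟩ := exists_apex hs
  by_cases h0 : 0 ≤ bary t v p
  · left
    rw [cellSet, (isBary_bary t).mem_convexHull_self_iff, htv, Finset.forall_mem_insert]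
    exact ⟨h0, fun y hy => (hpt y hy).le⟩
  · right
    rw [cellSet, (isBary_bary s).mem_convexHull_self_iff, hsw, Finset.forall_mem_insert]
    refine ⟨?_, fun y hy => (hps y hy).le⟩
    push Not at h0
    have hneg := bary_apex_neg ⟨x, hx⟩ ht hs hts hv hw htv hsw
    have hpos := (isOutward_sgn_smul_normal (o := o) ht hv htv).pos x (by
      rw [htv, Finset.erase_insert hv]; exact hx)
    have hne : inner ℝ (o.normal e) (x - v) ≠ 0 := by
      intro h
      rw [inner_smul_left, h, mul_zero] at hpos
      exact lt_irrefl _ hpos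
    have h1 := inner_normal_eq (o := o) hv htv hx p
    rw [inner_normal_eq (o := o) hw hsw hx p, inner_normal_eq (o := o) hv htv hx w,
      ← mul_assoc] at h1
    have h2 := mul_right_cancel₀ hne h1
    by_contra! h3
    have := mul_pos_of_neg_of_neg h3 hneg
    linarith

end Orientation

/-! ### Polynomial fields and Green's formula on a fine element -/

section Poly
variable {d : ℕ}

@[simp] theorem ev_zero (x : Pt d) : ev (0 : RPoly d) x = 0 := by simp [ev]
@[simp] theorem ev_one (x : Pt d) : ev (1 : RPoly d) x = 1 := by simp [ev]

theorem ev_sum {κ : Type*} (s : Finset κ) (q : κ → RPoly d) (x : Pt d) :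
    ev (∑ i ∈ s, q i) x = ∑ i ∈ s, ev (q i) x := by simp [ev]

theorem hasFDerivAt_ev (q : RPoly d) (x : Pt d) :
    HasFDerivAt (ev q) (∑ i, ev (MvPolynomial.pderiv i q) x •
      (EuclideanSpace.proj i : Pt d →L[ℝ] ℝ)) x := by
  induction q using MvPolynomial.induction_on with
  | C a =>
    have : ev (MvPolynomial.C a : RPoly d) = fun _ => a := by ext; simp [ev]
    rw [this]
    simpa using hasFDerivAt_const a x
  | add p q hp hq =>
    have : ev (p + q) = fun y => ev p y + ev q y := by ext; simp [ev]
    rw [this]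
    refine (hp.add hq).congr_fderiv ?_
    rw [← Finset.sum_add_distrib]
    refine Finset.sum_congr rfl fun i _ => ?_
    rw [← add_smul]
    simp [ev]
  | mul_X p j hp =>
    have : ev (p * MvPolynomial.X j) = fun y => ev p y * y j := by ext; simp [ev]
    rw [this]
    have hj : HasFDerivAt (fun y : Pt d => y j) (EuclideanSpace.proj j : Pt d →L[ℝ] ℝ) x :=
      (EuclideanSpace.proj j : Pt d →L[ℝ] ℝ).hasFDerivAt
    refine (hp.mul hj).congr_fderiv ?_
    ext v
    have e : ∀ i, ev (MvPolynomial.pderiv i (p * MvPolynomial.X j)) x =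
        ev (MvPolynomial.pderiv i p) x * x j + if i = j then ev p x else 0 := by
      intro i
      rw [MvPolynomial.pderiv_mul, MvPolynomial.pderiv_X]
      by_cases h : i = j
      · subst h; simp [ev]
      · simp [ev, h, Ne.symm h]
    simp only [e]
    simp [add_mul, Finset.sum_add_distrib, Finset.mul_sum]
    rw [add_comm]
    congr 1
    exact Finset.sum_congr rfl fun i _ => by ring

theorem contDiff_ev (q : RPoly d) {k : WithTop ℕ∞} : ContDiff ℝ k (ev q) := by
  induction q using MvPolynomial.induction_on with
  | C a =>
    have : ev (MvPolynomial.C a : RPoly d) = fun _ => a := by ext; simp [ev]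
    rw [this]; exact contDiff_const
  | add p q hp hq =>
    have : ev (p + q) = fun y => ev p y + ev q y := by ext; simp [ev]
    rw [this]; exact hp.add hq
  | mul_X p j hp =>
    have : ev (p * MvPolynomial.X j) = fun y => ev p y * y j := by ext; simp [ev]
    rw [this]
    exact hp.mul (EuclideanSpace.proj j : Pt d →L[ℝ] ℝ).contDiff

theorem continuous_ev (q : RPoly d) : Continuous (ev q) := (contDiff_ev q (k := 0)).continuous

theorem fderiv_ev_single (q : RPoly d) (x : Pt d) (i : Fin d) :
    fderiv ℝ (ev q) x (EuclideanSpace.single i 1) = ev (MvPolynomial.pderiv i q) x := by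
  rw [(hasFDerivAt_ev q x).fderiv]
  simp

/-- The divergence of a polynomial vector field, as a polynomial. -/
def divPoly (u : Fin d → RPoly d) : RPoly d := ∑ i, MvPolynomial.pderiv i (u i)

/-- The vector field given by a tuple of polynomials. -/
def evField (u : Fin d → RPoly d) (x : Pt d) : Pt d := WithLp.toLp 2 fun i => ev (u i) x

theorem continuous_evField (u : Fin d → RPoly d) : Continuous (evField u) := by
  unfold evField
  have := fun i => continuous_ev (u i)
  fun_prop

theorem evField_eq_sum (u : Fin d → RPoly d) (x : Pt d) :
    evField u x = ∑ i, ev (u i) x • EuclideanSpace.single i (1 : ℝ) := by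
  ext j
  simp [evField, Pi.single_apply]

end Poly

section Orientation

variable {n : ℕ} {Ω : Set (Pt (n + 1))} {τ : Triangulation (n + 1) Ω} {o : FaceOrientation τ}

/-- The fine face of `t` opposite to the vertex `x`. -/
def facetOpp (t : τ.Cell) (x : t.1) : τ.Facet :=
  ⟨t.1.erase x, τ.down_closed t.2.1 (Finset.erase_subset _ _)
    (Finset.card_pos.1 (by rw [Finset.card_erase_of_mem x.2, t.2.2]; omega)),
    by rw [Finset.card_erase_of_mem x.2, t.2.2]; omega⟩

theorem mem_adj_facetOpp (t : τ.Cell) (x : t.1) : t ∈ adj (facetOpp t x) :=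
  mem_adj.2 (Finset.erase_subset _ _)

theorem sum_facetOpp (t : τ.Cell) (H : τ.Facet → ℝ) :
    ∑ x : t.1, H (facetOpp t x) = ∑ e with t ∈ adj e, H e := by
  refine Finset.sum_bij (fun x _ => facetOpp t x) (fun x _ => ?_) (fun x _ y _ hxy => ?_)
    (fun e he => ?_) fun _ _ => rfl
  · exact Finset.mem_filter.2 ⟨Finset.mem_univ _, mem_adj_facetOpp t x⟩
  · have h : t.1.erase x = t.1.erase y := congrArg Subtype.val hxy
    by_contra hne
    have : (x : Pt (n + 1)) ∈ t.1.erase y :=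
      Finset.mem_erase.2 ⟨fun h => hne (Subtype.ext h), x.2⟩
    rw [← h] at this
    simp at this
  · obtain ⟨v, hv, htv⟩ := exists_apex (Finset.mem_filter.1 he).2
    refine ⟨⟨v, by simp [htv]⟩, Finset.mem_univ _, Subtype.ext ?_⟩
    change t.1.erase v = e.1
    rw [htv, Finset.erase_insert hv]

theorem isOutward_facetOpp (o : FaceOrientation τ) (t : τ.Cell) (x : t.1) :
    IsOutward t.1 x (sgn o (facetOpp t x) t • o.normal (facetOpp t x)) :=
  isOutward_sgn_smul_normal (mem_adj_facetOpp t x) (by simp [facetOpp])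
    (by simp [facetOpp, Finset.insert_erase])

/-- A fine face has finite surface measure, and almost all of it is its relative interior, where
the barycentric coordinates at its vertices are positive. -/
theorem facetSet_measure_ne_top_and_bary_pos (o : FaceOrientation τ) {e : τ.Facet} {t : τ.Cell}
    (ht : t ∈ adj e) :
    Measure.euclideanHausdorffMeasure n (facetSet e) ≠ ∞ ∧
      ∀ x ∈ e.1, ∀ᵐ p ∂(Measure.euclideanHausdorffMeasure n).restrict (facetSet e),
        0 < bary t x p := by
  obtain ⟨v, hv, htv⟩ := exists_apex ht
  have h := (isBary_bary t).facet_measure_ne_top_and_pos t.2.2 (a := v) (by simp [htv])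
    (isOutward_sgn_smul_normal (o := o) ht hv htv)
  have he : t.1.erase v = e.1 := by rw [htv, Finset.erase_insert hv]
  rw [he] at h
  exact h

theorem integrableOn_facetSet (o : FaceOrientation τ) (e : τ.Facet) {g : Pt (n + 1) → ℝ}
    (hg : Continuous g) : IntegrableOn g (facetSet e) (Measure.euclideanHausdorffMeasure n) := by
  have hK : IsCompact (facetSet e) := isCompact_convexHull e.1
  obtain ⟨C, hC⟩ := hK.exists_bound_of_continuousOn hg.continuousOn
  refine Measure.integrableOn_of_bounded
    (facetSet_measure_ne_top_and_bary_pos o (minus_mem_adj o e)).1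
    hg.aestronglyMeasurable (M := C) ?_
  exact (ae_restrict_iff' hK.isClosed.measurableSet).2 (Filter.Eventually.of_forall hC)

theorem setIntegral_cell_fderiv (o : FaceOrientation τ) (t : τ.Cell) {g : Pt (n + 1) → ℝ}
    (hg : ContDiff ℝ 1 g) (v : Pt (n + 1)) :
    ∫ x in cellSet t, fderiv ℝ g x v =
      ∑ e with t ∈ adj e, sgn o e t * inner ℝ (o.normal e) v * faceInt e g := by
  let ν : Pt (n + 1) → Pt (n + 1) := fun x => if h : x ∈ t.1 then
    sgn o (facetOpp t ⟨x, h⟩) t • o.normal (facetOpp t ⟨x, h⟩) else 0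
  have hν : ∀ x ∈ t.1, IsOutward t.1 x (ν x) := fun x hx => by
    simp only [ν, hx, dif_pos]
    exact isOutward_facetOpp o t ⟨x, hx⟩
  rw [cellSet, (isBary_bary t).setIntegral_fderiv_eq t.2.2 hν hg v, ← sum_facetOpp,
    ← Finset.sum_attach]
  refine Finset.sum_congr rfl fun x _ => ?_
  simp only [ν, x.2, dif_pos, inner_smul_left]
  rfl

/-- Green's formula on a fine element, for a polynomial field and a scalar `C¹` function. -/
theorem setIntegral_cell_div (o : FaceOrientation τ) (u : τ.Cell → Fin (n + 1) → RPoly (n + 1))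
    (t : τ.Cell) {φ : Pt (n + 1) → ℝ} (hφ : ContDiff ℝ 1 φ) :
    (∫ x in cellSet t, fderiv ℝ φ x (evField (u t) x)) +
        ∫ x in cellSet t, φ x * ev (divPoly (u t)) x =
      ∑ e with t ∈ adj e, sgn o e t * faceInt e (fun x => φ x * normalTrace o u e t x) := by
  have hφ' : Continuous (fderiv ℝ φ) := hφ.continuous_fderiv one_ne_zero
  have hφ0 := hφ.continuous
  have hK := isCompact_convexHull t.1
  have hI : ∀ g : Pt (n + 1) → ℝ, Continuous g → IntegrableOn g (cellSet t) := fun g hg =>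
    hg.continuousOn.integrableOn_compact hK
  have c1 := continuous_evField (u t)
  have c2 := continuous_ev (divPoly (u t))
  have c3 := fun i => continuous_ev (u t i)
  have c4 := fun i => continuous_ev (MvPolynomial.pderiv i (u t i))
  have hfd : ∀ i x, fderiv ℝ (fun x => φ x * ev (u t i) x) x (EuclideanSpace.single i 1) =
      ev (u t i) x * fderiv ℝ φ x (EuclideanSpace.single i 1) +
        φ x * ev (MvPolynomial.pderiv i (u t i)) x := by
    intro i x
    rw [fderiv_fun_mul (hφ.differentiable one_ne_zero x)
      ((contDiff_ev (u t i) (k := 1)).differentiable one_ne_zero x), ← fderiv_ev_single]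
    simp
    ring
  rw [← integral_add (hI _ (by fun_prop)) (hI _ (by fun_prop))]
  have e1 : ∀ x, fderiv ℝ φ x (evField (u t) x) + φ x * ev (divPoly (u t)) x =
      ∑ i, fderiv ℝ (fun x => φ x * ev (u t i) x) x (EuclideanSpace.single i 1) := by
    intro x
    simp only [hfd, Finset.sum_add_distrib, evField_eq_sum, map_sum, map_smul, smul_eq_mul,
      divPoly, ev_sum, Finset.mul_sum]
  simp only [e1]
  rw [integral_finsetSum _ fun i _ => hI _ (by simp only [hfd]; fun_prop)]
  simp only [setIntegral_cell_fderiv o t (hφ.mul (contDiff_ev (u t _) (k := 1)))]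
  rw [Finset.sum_comm]
  refine Finset.sum_congr rfl fun e _ => ?_
  simp only [mul_assoc, ← Finset.mul_sum]
  congr 1
  unfold faceInt normalTrace
  simp only [Finset.mul_sum]
  rw [integral_finsetSum]
  · refine Finset.sum_congr rfl fun i _ => ?_
    rw [← integral_const_mul]
    congr 1
    ext1 x
    rw [EuclideanSpace.inner_single_right]; simp only [conj_trivial]
    ring
  · intro i _
    exact integrableOn_facetSet o e (by fun_prop)

end Orientation

/-! ### The weak divergence of a piecewise polynomial field -/

section Domain

variable {d : ℕ} {Ω : Set (Pt d)} {τ : Triangulation d Ω}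

theorem cellSet_subset_closure (t : τ.Cell) : cellSet t ⊆ closure Ω := by
  rw [← τ.space_eq]
  exact Set.subset_biUnion_of_mem (u := fun s : Finset (Pt d) => convexHull ℝ (s : Set (Pt d)))
    t.2.1

theorem interior_cellSet_subset (t : τ.Cell) : interior (cellSet t) ⊆ Ω :=
  (interior_mono (cellSet_subset_closure t)).trans τ.interior_eq.subset

theorem closure_subset_iUnion_cellSet (τ : Triangulation d Ω) :
    closure Ω ⊆ ⋃ t : τ.Cell, cellSet t := by
  rw [← τ.space_eq]
  refine Set.iUnion₂_subset fun e he => ?_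
  obtain ⟨t, ht, het, hc⟩ := τ.pure e he
  exact (convexHull_mono (by exact_mod_cast het)).trans
    (Set.subset_iUnion (fun t : τ.Cell => cellSet t) ⟨t, ht, hc⟩)

theorem Triangulation.isOpen_domain (τ : Triangulation d Ω) : IsOpen Ω :=
  τ.interior_eq ▸ isOpen_interior

theorem isCompact_cellSet (t : τ.Cell) : IsCompact (cellSet t) := isCompact_convexHull t.1

theorem interior_cellSet_ae_eq (t : τ.Cell) :
    interior (cellSet t) =ᵐ[volume] cellSet t := by
  refine (interior_subset.eventuallyLE).antisymm ?_
  exact ae_le_set.2 (volume_convexHull_diff_interior t.1)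

theorem iUnion_cellSet_ae_eq (τ : Triangulation d Ω) :
    (⋃ t : τ.Cell, cellSet t) =ᵐ[volume] Ω := by
  refine Filter.EventuallyLE.antisymm ?_
    (subset_closure.trans (closure_subset_iUnion_cellSet τ)).eventuallyLE
  rw [ae_le_set, Set.iUnion_sdiff]
  refine measure_iUnion_null fun t => measure_mono_null ?_ (volume_convexHull_diff_interior t.1)
  exact Set.sdiff_subset_sdiff_right (interior_cellSet_subset t)

theorem aedisjoint_cellSet {t s : τ.Cell} (hts : t ≠ s) :
    AEDisjoint volume (cellSet t) (cellSet s) := by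
  refine measure_mono_null ?_ (volume_convexHull_diff_interior t.1)
  rintro z ⟨hz, hz'⟩
  exact ⟨hz, fun h => hts (cell_eq_of_mem_interior h hz')⟩

theorem integrableOn_cellSet {w : Pt d → ℝ} (hw : MemLp w 2 (volume.restrict Ω)) (t : τ.Cell) :
    IntegrableOn w (cellSet t) := by
  have h1 : MemLp w 2 (volume.restrict (interior (cellSet t))) :=
    hw.mono_measure (Measure.restrict_mono (interior_cellSet_subset t) le_rfl)
  rw [Measure.restrict_congr_set (interior_cellSet_ae_eq t)] at h1
  have : IsFiniteMeasure (volume.restrict (cellSet t)) :=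
    ⟨by simpa using (isCompact_cellSet t).measure_lt_top⟩
  exact h1.integrable (by norm_num)

theorem setIntegral_iUnion_cellSet {κ : Type*} [Fintype κ] {j : κ → τ.Cell}
    (hj : Function.Injective j) {w : Pt d → ℝ} (hw : ∀ t : τ.Cell, IntegrableOn w (cellSet t)) :
    ∫ x in ⋃ k, cellSet (j k), w x = ∑ k, ∫ x in cellSet (j k), w x := by
  rw [integral_iUnion_ae (fun k => (isCompact_cellSet (j k)).isClosed.nullMeasurableSet)
    (fun a b hab => aedisjoint_cellSet (hj.ne hab)) (integrableOn_finite_iUnion.2 fun k => hw _),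
    tsum_fintype]

theorem setIntegral_domain (τ : Triangulation d Ω) {w : Pt d → ℝ}
    (hw : ∀ t : τ.Cell, IntegrableOn w (cellSet t)) :
    ∫ x in Ω, w x = ∑ t : τ.Cell, ∫ x in cellSet t, w x := by
  rw [← setIntegral_congr_set (iUnion_cellSet_ae_eq τ)]
  exact setIntegral_iUnion_cellSet (j := id) Function.injective_id hw

theorem setIntegral_region {ι : Type} [Fintype ι] (𝒯 : CoarsePartition τ ι) (T : ι) {w : Pt d → ℝ}
    (hw : ∀ t : τ.Cell, IntegrableOn w (cellSet t)) :
    ∫ x in 𝒯.region T, w x = ∑ t : 𝒯.Sub T, ∫ x in cellSet t.1, w x :=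
  setIntegral_iUnion_cellSet (j := fun t : 𝒯.Sub T => t.1) Subtype.val_injective hw

end Domain

section WeakDiv

variable {n : ℕ} {Ω : Set (Pt (n + 1))} {τ : Triangulation (n + 1) Ω} (o : FaceOrientation τ)
  {u : τ.Cell → Fin (n + 1) → RPoly (n + 1)} {w : Pt (n + 1) → ℝ}

include o in
/-- The weak divergence against a test function: elementwise divergences and normal traces on the
fine faces. -/
theorem setIntegral_weakDiv_mul (hw : IsWeakDiv Ω (field u) w) {φ : Pt (n + 1) → ℝ}
    (hφ : ContDiff ℝ ((⊤ : ℕ∞) : WithTop ℕ∞) φ) (hφc : HasCompactSupport φ) (hφs : tsupport φ ⊆ Ω) :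
    ∫ x in Ω, w x * φ x = (∑ t : τ.Cell, ∫ x in cellSet t, φ x * ev (divPoly (u t)) x) -
      ∑ t : τ.Cell, ∑ e with t ∈ adj e,
        sgn o e t * faceInt e (fun x => φ x * normalTrace o u e t x) := by
  have hφ1 : ContDiff ℝ 1 φ := hφ.of_le (by exact_mod_cast le_top)
  have hφ' : Continuous (fderiv ℝ φ) := hφ1.continuous_fderiv one_ne_zero
  have hI : ∀ (t : τ.Cell) (g : Pt (n + 1) → ℝ), Continuous g → IntegrableOn g (cellSet t) :=
    fun t g hg => hg.continuousOn.integrableOn_compact (isCompact_cellSet t)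
  have h1 := hw φ hφ hφc hφs
  have h2 : ∫ x in Ω, fderiv ℝ φ x (field u x) =
      ∑ t : τ.Cell, ∫ x in cellSet t, fderiv ℝ φ x (evField (u t) x) := by
    have e : ∀ x, fderiv ℝ φ x (field u x) = ∑ t : τ.Cell,
        (interior (cellSet t)).indicator (fun x => fderiv ℝ φ x (evField (u t) x)) x := by
      intro x
      rw [field, map_sum]
      refine Finset.sum_congr rfl fun t _ => ?_
      by_cases hx : x ∈ interior (cellSet t)
      · rw [Set.indicator_of_mem hx, Set.indicator_of_mem hx]; rfl
      · rw [Set.indicator_of_notMem hx, Set.indicator_of_notMem hx, map_zero]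
    simp only [e]
    have c1 := fun t => continuous_evField (u t)
    rw [integral_finsetSum]
    · refine Finset.sum_congr rfl fun t _ => ?_
      rw [setIntegral_indicator isOpen_interior.measurableSet,
        Set.inter_eq_right.2 (interior_cellSet_subset t)]
      exact setIntegral_congr_set (interior_cellSet_ae_eq t)
    · intro t _
      refine Integrable.integrableOn ?_
      rw [integrable_indicator_iff isOpen_interior.measurableSet]
      have := c1 t
      exact (hI t _ (by fun_prop)).mono_set interior_subset
  have h3 := Finset.sum_congr rfl fun t (_ : t ∈ (Finset.univ : Finset τ.Cell)) =>
    setIntegral_cell_div o u t hφ1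
  rw [Finset.sum_add_distrib] at h3
  rw [h2] at h1
  linarith

include o in
/-- The weak divergence is the elementwise one: for test functions supported inside one fine
element no face term is left. -/
theorem weakDiv_ae_eq (hw2 : MemLp w 2 (volume.restrict Ω)) (hw : IsWeakDiv Ω (field u) w)
    (t : τ.Cell) : ∀ᵐ x ∂(volume.restrict (cellSet t)), w x = ev (divPoly (u t)) x := by
  have hc := continuous_ev (divPoly (u t))
  have hwt := integrableOn_cellSet hw2 t
  have hdt : IntegrableOn (ev (divPoly (u t))) (cellSet t) :=
    hc.continuousOn.integrableOn_compact (isCompact_cellSet t)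
  have key := (isOpen_interior (s := cellSet t)).ae_eq_zero_of_integral_contDiff_smul_eq_zero
    (μ := volume.restrict (cellSet t)) (f := fun x => w x - ev (divPoly (u t)) x)
    ((hwt.sub hdt).integrableOn.locallyIntegrableOn) ?_
  · rw [← Measure.restrict_congr_set (interior_cellSet_ae_eq t)] at key ⊢
    filter_upwards [key, ae_restrict_mem isOpen_interior.measurableSet] with x hx hxt
    exact sub_eq_zero.1 (hx hxt)
  · intro φ hφ hφc hφs
    have hoff : ∀ F ∈ τ.faces, ¬ t.1 ⊆ F → ∀ x ∈ convexHull ℝ (F : Set (Pt (n + 1))), φ x = 0 := by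
      intro F hF htF x hx
      by_contra hne
      exact htF (subset_of_mem_interior hF (hφs (subset_tsupport φ hne)) hx)
    have h1 := setIntegral_weakDiv_mul o hw hφ hφc (hφs.trans (interior_cellSet_subset t))
    have h2 : ∫ x in Ω, w x * φ x = ∫ x in cellSet t, w x * φ x := by
      rw [← setIntegral_congr_set (interior_cellSet_ae_eq t)]
      refine setIntegral_eq_of_subset_of_forall_sdiff_eq_zero τ.isOpen_domain.measurableSet
        (interior_cellSet_subset t) fun x hx => ?_
      rw [image_eq_zero_of_notMem_tsupport fun h => hx.2 (hφs h), mul_zero]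
    rw [h2, Finset.sum_eq_single t, Finset.sum_eq_zero (s := Finset.univ), sub_zero] at h1
    · have hφb := hφ.continuous
      obtain ⟨C, hC⟩ := hφc.exists_bound_of_continuous hφb
      simp only [smul_eq_mul, mul_sub]
      rw [integral_sub, ← h1, sub_eq_zero]
      · exact integral_congr_ae (Filter.Eventually.of_forall fun x => mul_comm _ _)
      · exact hwt.bdd_mul hφb.aestronglyMeasurable (Filter.Eventually.of_forall hC)
      · exact hdt.bdd_mul hφb.aestronglyMeasurable (Filter.Eventually.of_forall hC)
    · intro s _
      refine Finset.sum_eq_zero fun e _ => ?_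
      rw [faceInt, setIntegral_eq_zero_of_forall_eq_zero, mul_zero]
      intro x hx
      rw [hoff e.1 e.2.1 (fun h => ?_) x hx, zero_mul]
      have := Finset.card_le_card h
      rw [t.2.2, e.2.2] at this
      omega
    · intro s _ hst
      refine setIntegral_eq_zero_of_forall_eq_zero fun x hx => ?_
      rw [hoff s.1 s.2.1 (fun h => hst (cell_eq_of_subset h).symm) x hx, zero_mul]
    · exact fun h => absurd (Finset.mem_univ t) h

include o in
theorem setIntegral_region_weakDiv {ι : Type} [Fintype ι] (𝒯 : CoarsePartition τ ι)
    (hw2 : MemLp w 2 (volume.restrict Ω)) (hw : IsWeakDiv Ω (field u) w) (T : ι) :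
    ∫ x in 𝒯.region T, w x = ∑ t : 𝒯.Sub T, ∑ e with t.1 ∈ adj e,
        sgn o e t.1 * faceInt e (normalTrace o u e t.1) := by
  rw [setIntegral_region 𝒯 T (integrableOn_cellSet hw2)]
  refine Finset.sum_congr rfl fun t _ => ?_
  rw [integral_congr_ae (weakDiv_ae_eq o hw2 hw t.1)]
  have := setIntegral_cell_div o u t.1 (φ := fun _ => 1) contDiff_const
  simpa using this

/-- Both sides of an interior fine face have the same normal flux. Test functions supported near
the relative interior of `e` see no other fine face, and the volume terms cancel because the weak
divergence is the elementwise one. -/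
theorem faceInt_normalTrace_eq (hw2 : MemLp w 2 (volume.restrict Ω))
    (hw : IsWeakDiv Ω (field u) w)
    {e : τ.Facet} {t s : τ.Cell} (ht : t ∈ adj e) (hs : s ∈ adj e) (hts : t ≠ s) :
    faceInt e (normalTrace o u e t) = faceInt e (normalTrace o u e s) := by
  set μe := (Measure.euclideanHausdorffMeasure n).restrict (facetSet e)
  let U : Set (Pt (n + 1)) := {p | ∀ x ∈ e.1, 0 < bary t x p ∧ 0 < bary s x p}
  have hU : IsOpen U := by
    have : U = ⋂ x ∈ e.1, {p | 0 < bary t x p ∧ 0 < bary s x p} := by ext; simp [U]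
    rw [this]
    exact isOpen_biInter_finset fun x _ =>
      (isOpen_lt continuous_const (continuous_bary t x)).inter
        (isOpen_lt continuous_const (continuous_bary s x))
  -- `U` is a neighbourhood of the relative interior of `e` that avoids all other fine faces
  have hUc : U ⊆ cellSet t ∪ cellSet s := fun p hp =>
    mem_union_of_bary_pos o ht hs hts (fun x hx => (hp x hx).1) fun x hx => (hp x hx).2
  have hUΩ : U ⊆ Ω :=
    (interior_maximal (hUc.trans (Set.union_subset (cellSet_subset_closure t)
      (cellSet_subset_closure s))) hU).trans τ.interior_eq.subset
  have hUf : ∀ (f : τ.Facet), f ≠ e → ∀ p ∈ facetSet f, p ∉ U := by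
    intro f hfe p hp hpU
    refine hfe (facet_eq_of_subset ?_).symm
    rcases hUc hpU with h | h
    · exact subset_of_bary_pos f.2.1 (mem_adj.1 ht) h hp fun x hx => (hpU x hx).1
    · exact subset_of_bary_pos f.2.1 (mem_adj.1 hs) h hp fun x hx => (hpU x hx).2
  have hcont : ∀ r, Continuous (normalTrace o u e r) := fun r => by
    have := fun i => continuous_ev (u r i)
    unfold normalTrace; fun_prop
  have hint : ∀ r, Integrable (normalTrace o u e r) μe := fun r =>
    integrableOn_facetSet o e (hcont r)
  have key := hU.ae_eq_zero_of_integral_contDiff_smul_eq_zero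
    (μ := μe) (f := fun x => normalTrace o u e t x - normalTrace o u e s x)
    (((hint t).sub (hint s)).integrableOn.locallyIntegrableOn) ?_
  · have h1 := (Finset.eventually_all e.1).2 (facetSet_measure_ne_top_and_bary_pos o ht).2
    have h2 := (Finset.eventually_all e.1).2 (facetSet_measure_ne_top_and_bary_pos o hs).2
    refine integral_congr_ae ?_
    filter_upwards [key, h1, h2] with p hp hp1 hp2
    exact sub_eq_zero.1 (hp fun x hx => ⟨hp1 x hx, hp2 x hx⟩)
  · intro φ hφ hφc hφs
    have h1 := setIntegral_weakDiv_mul o hw hφ hφc (hφs.trans hUΩ)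
    have h2 : ∫ x in Ω, w x * φ x = ∑ t : τ.Cell, ∫ x in cellSet t, φ x * ev (divPoly (u t)) x := by
      obtain ⟨C, hC⟩ := hφc.exists_bound_of_continuous hφ.continuous
      rw [setIntegral_domain τ fun r => (integrableOn_cellSet hw2 r).mul_bdd
        hφ.continuous.aestronglyMeasurable (Filter.Eventually.of_forall hC)]
      refine Finset.sum_congr rfl fun r _ => integral_congr_ae ?_
      filter_upwards [weakDiv_ae_eq o hw2 hw r] with x hx
      rw [hx, mul_comm]
    rw [h2, eq_sub_iff_add_eq, add_eq_left, Finset.sum_comm' (t' := Finset.univ)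
      (s' := fun e => adj e) (by simp)] at h1
    rw [Finset.sum_eq_single e, adj_eq_pair o ht hs hts, Finset.sum_pair hts,
      eq_neg_of_add_eq_zero_left (sgn_add_sgn (o := o) ht hs hts)] at h1
    · have hφi : ∀ r, Integrable (fun x => φ x * normalTrace o u e r x) μe := fun r =>
        integrableOn_facetSet o e (hφ.continuous.mul (hcont r))
      simp only [smul_eq_mul, mul_sub]
      rw [integral_sub (hφi t) (hφi s)]
      have hne : sgn o e s ≠ 0 := by unfold sgn; split_ifs <;> norm_num
      have h3 : sgn o e s * (faceInt e (fun x => φ x * normalTrace o u e t x) -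
        faceInt e (fun x => φ x * normalTrace o u e s x)) = 0 := by linarith
      exact (mul_eq_zero.1 h3).resolve_left hne
    · intro f _ hfe
      refine Finset.sum_eq_zero fun r _ => ?_
      rw [faceInt, setIntegral_eq_zero_of_forall_eq_zero, mul_zero]
      intro x hx
      rw [image_eq_zero_of_notMem_tsupport fun h => hUf f hfe x hx (hφs h), zero_mul]
    · exact fun h => absurd (Finset.mem_univ e) h

end WeakDiv

/-! ### Conservation on coarse elements -/

section Coarse

variable {n : ℕ} {Ω : Set (Pt (n + 1))} {τ : Triangulation (n + 1) Ω} (o : FaceOrientation τ)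
  {ι : Type} {𝒯 : CoarsePartition τ ι}

theorem CoarsePartition.mem_interface {T S : ι} {e : τ.Facet} :
    e ∈ 𝒯.interface T S ↔ ∃ t ∈ adj e, ∃ s ∈ adj e, 𝒯.elem t = T ∧ 𝒯.elem s = S := by
  simp only [CoarsePartition.interface, Finset.mem_filter, Finset.mem_univ, true_and]

theorem CoarsePartition.mem_boundaryFace {T : ι} {e : τ.Facet} :
    e ∈ 𝒯.boundaryFace T ↔ ∃ t, adj e = {t} ∧ 𝒯.elem t = T := by
  simp only [CoarsePartition.boundaryFace, Finset.mem_filter, Finset.mem_univ, true_and]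

theorem CoarsePartition.interface_comm (T S : ι) : 𝒯.interface T S = 𝒯.interface S T := by
  ext e
  simp only [mem_interface]
  constructor <;> rintro ⟨t, ht, s, hs, h1, h2⟩ <;> exact ⟨s, hs, t, ht, h2, h1⟩

theorem CoarsePartition.mem_facesOf [Fintype ι] {T : ι} {E : Finset τ.Facet} : E ∈ 𝒯.facesOf T ↔
    E ≠ ∅ ∧ (E = 𝒯.boundaryFace T ∨ ∃ S, S ≠ T ∧ E = 𝒯.interface T S) := by
  simp only [CoarsePartition.facesOf, Finset.mem_erase, Finset.mem_insert, Finset.mem_image,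
    Finset.mem_univ, and_true, eq_comm]

include o in
theorem interface_eq_of_adj {T S : ι} (hTS : T ≠ S) {e : τ.Facet} (he : e ∈ 𝒯.interface T S) :
    ∃ t s, t ≠ s ∧ adj e = {t, s} ∧ 𝒯.elem t = T ∧ 𝒯.elem s = S := by
  obtain ⟨t, ht, s, hs, rfl, rfl⟩ := CoarsePartition.mem_interface.1 he
  have hts : t ≠ s := fun h => hTS (h ▸ rfl)
  exact ⟨t, s, hts, adj_eq_pair o ht hs hts, rfl, rfl⟩

include o in
/-- A fine face belongs to at most one coarse face. -/
theorem coarseFace_eq_of_mem [Fintype ι] {T T' : ι} {E E' : Finset τ.Facet} (hE : E ∈ 𝒯.facesOf T)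
    (hE' : E' ∈ 𝒯.facesOf T') {e : τ.Facet} (he : e ∈ E) (he' : e ∈ E') : E = E' := by
  obtain ⟨-, rfl | ⟨S, hS, rfl⟩⟩ := CoarsePartition.mem_facesOf.1 hE <;>
  obtain ⟨-, rfl | ⟨S', hS', rfl⟩⟩ := CoarsePartition.mem_facesOf.1 hE'
  · obtain ⟨t, ht, rfl⟩ := CoarsePartition.mem_boundaryFace.1 he
    obtain ⟨t', ht', rfl⟩ := CoarsePartition.mem_boundaryFace.1 he'
    rw [ht, Finset.singleton_inj] at ht'
    rw [ht']
  · obtain ⟨t, ht, rfl⟩ := CoarsePartition.mem_boundaryFace.1 he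
    obtain ⟨s, s', hss, hs, -, -⟩ := interface_eq_of_adj o hS'.symm he'
    have := congrArg Finset.card (ht.symm.trans hs)
    rw [Finset.card_pair hss, Finset.card_singleton] at this
    omega
  · obtain ⟨t, ht, rfl⟩ := CoarsePartition.mem_boundaryFace.1 he'
    obtain ⟨s, s', hss, hs, -, -⟩ := interface_eq_of_adj o hS.symm he
    have := congrArg Finset.card (ht.symm.trans hs)
    rw [Finset.card_pair hss, Finset.card_singleton] at this
    omega
  · obtain ⟨t, t', htt, ht, rfl, rfl⟩ := interface_eq_of_adj o hS.symm he
    obtain ⟨s, s', hss, hs, rfl, rfl⟩ := interface_eq_of_adj o hS'.symm he'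
    have h1 : t ∈ ({s, s'} : Finset τ.Cell) := by rw [← hs, ht]; simp
    have h2 : t' ∈ ({s, s'} : Finset τ.Cell) := by rw [← hs, ht]; simp
    simp only [Finset.mem_insert, Finset.mem_singleton] at h1 h2
    rcases h1 with rfl | rfl <;> rcases h2 with rfl | rfl
    · exact absurd rfl htt
    · rfl
    · exact CoarsePartition.interface_comm _ _
    · exact absurd rfl htt

/-- A fine face of a fine element `t` belongs to a coarse face of the coarse element of `t`, or it
separates `t` from a fine element of the same coarse element. -/
theorem exists_coarseFace_or [Fintype ι] {e : τ.Facet} {t : τ.Cell} (ht : t ∈ adj e) :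
    (∃ E ∈ 𝒯.facesOf (𝒯.elem t), e ∈ E) ∨ ∃ s ∈ adj e, t ≠ s ∧ 𝒯.elem s = 𝒯.elem t := by
  by_cases h1 : ∃ s ∈ adj e, 𝒯.elem s ≠ 𝒯.elem t
  · obtain ⟨s, hs, hst⟩ := h1
    have he : e ∈ 𝒯.interface (𝒯.elem t) (𝒯.elem s) :=
      CoarsePartition.mem_interface.2 ⟨t, ht, s, hs, rfl, rfl⟩
    exact Or.inl ⟨_, CoarsePartition.mem_facesOf.2
      ⟨Finset.ne_empty_of_mem he, Or.inr ⟨_, hst, rfl⟩⟩, he⟩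
  · push Not at h1
    by_cases h2 : ∃ s ∈ adj e, t ≠ s
    · obtain ⟨s, hs, hts⟩ := h2
      exact Or.inr ⟨s, hs, hts, h1 s hs⟩
    · push Not at h2
      have he : e ∈ 𝒯.boundaryFace (𝒯.elem t) := CoarsePartition.mem_boundaryFace.2
        ⟨t, Finset.eq_singleton_iff_unique_mem.2 ⟨ht, fun s hs => (h2 s hs).symm⟩, rfl⟩
      exact Or.inl ⟨_, CoarsePartition.mem_facesOf.2
        ⟨Finset.ne_empty_of_mem he, Or.inl rfl⟩, he⟩

include o in
/-- A sum over the coarse faces is a sum over all fine faces, for terms that vanish on fine faces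
interior to a coarse element. -/
theorem sum_coarseFaces [Fintype ι] {H : τ.Facet → ℝ}
    (hH : ∀ e, (∀ T, ∀ E ∈ 𝒯.facesOf T, e ∉ E) → H e = 0) :
    ∑ E ∈ 𝒯.coarseFaces, ∑ e ∈ E, H e = ∑ e, H e := by
  have hmem : ∀ E, E ∈ 𝒯.coarseFaces ↔ ∃ T, E ∈ 𝒯.facesOf T := fun E => by
    simp [CoarsePartition.coarseFaces]
  rw [← Finset.sum_biUnion (t := fun E => E)]
  · refine Finset.sum_subset (Finset.subset_univ _) fun e _ he => hH e fun T E hE heE => ?_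
    exact he (Finset.mem_biUnion.2 ⟨E, (hmem E).2 ⟨T, hE⟩, heE⟩)
  · intro E hE E' hE' hne
    obtain ⟨T, hT⟩ := (hmem E).1 hE
    obtain ⟨T', hT'⟩ := (hmem E').1 hE'
    exact Finset.disjoint_left.2 fun e he he' => hne (coarseFace_eq_of_mem o hT hT' he he')

/-- The indicator function of the coarse element `T`, as a piecewise polynomial function. -/
def elemIndicator (𝒯 : CoarsePartition τ ι) (T : ι) : τ.Broken :=
  fun t => if 𝒯.elem t = T then 1 else 0

/-- The jump of the indicator function of `T` across `e`: the sum of the signs of the sides of `e`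
that lie in `T`. It vanishes if `e` is interior to `T`. -/
def elemSgn (𝒯 : CoarsePartition τ ι) (T : ι) (e : τ.Facet) : ℝ :=
  ∑ t ∈ adj e with 𝒯.elem t = T, sgn o e t

theorem jump_elemIndicator (T : ι) (e : τ.Facet) (x : Pt (n + 1)) :
    jump o e (elemIndicator 𝒯 T) x = elemSgn o 𝒯 T e := by
  rw [jump, elemSgn, Finset.sum_filter]
  refine Finset.sum_congr rfl fun t _ => ?_
  unfold elemIndicator sgn
  by_cases h : 𝒯.elem t = T <;> simp [h]

include o in
theorem filter_adj_eq_pair {T : ι} {e : τ.Facet} {t s : τ.Cell} (ht : t ∈ adj e) (hs : s ∈ adj e)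
    (hts : t ≠ s) (htT : 𝒯.elem t = T) (hsT : 𝒯.elem s = T) :
    (adj e).filter (fun r => 𝒯.elem r = T) = {t, s} := by
  rw [Finset.filter_true_of_mem, adj_eq_pair o ht hs hts]
  intro r hr
  rw [adj_eq_pair o ht hs hts] at hr
  rcases Finset.mem_insert.1 hr with rfl | hr
  · exact htT
  · rw [Finset.mem_singleton.1 hr]; exact hsT

theorem elemSgn_eq_zero [Fintype ι] {T : ι} {e : τ.Facet} (he : ∀ T, ∀ E ∈ 𝒯.facesOf T, e ∉ E) :
    elemSgn o 𝒯 T e = 0 := by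
  by_cases h : ∃ t ∈ adj e, 𝒯.elem t = T
  · obtain ⟨t, ht, rfl⟩ := h
    rcases exists_coarseFace_or (𝒯 := 𝒯) ht with ⟨E, hE, heE⟩ | ⟨s, hs, hts, hsT⟩
    · exact absurd heE (he _ E hE)
    · rw [elemSgn, filter_adj_eq_pair o ht hs hts rfl hsT, Finset.sum_pair hts,
        sgn_add_sgn ht hs hts]
  · push Not at h
    rw [elemSgn, Finset.filter_false_of_mem h, Finset.sum_empty]

variable {m : ℕ} {P : Set (EuclideanSpace ℝ (Fin m))} (c : Coefficients τ P) (μ : P)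

theorem normalFlux_eq_zero (e : τ.Facet) (t : τ.Cell) {q : RPoly (n + 1)}
    (hq : ∀ i, MvPolynomial.pderiv i q = 0) (x : Pt (n + 1)) : normalFlux o c μ e t q x = 0 := by
  have : (fun i => ev (MvPolynomial.pderiv i q) x) = 0 := by ext i; simp [hq]
  rw [normalFlux, this, Matrix.mulVec_zero, zero_dotProduct, mul_zero]

theorem meanFlux_elemIndicator (T : ι) (e : τ.Facet) (x : Pt (n + 1)) :
    meanFlux o c μ e (elemIndicator 𝒯 T) x = 0 := by
  refine Finset.sum_eq_zero fun t _ => ?_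
  rw [normalFlux_eq_zero, mul_zero]
  intro i
  unfold elemIndicator
  split_ifs <;> simp

/-- The total numerical flux `∫_e (-{(λ κ ∇_h p) · n_e} + σ_E ⟦p⟧)` through the fine face `e`. -/
def numFlux (α : τ.Facet → ℝ) (p : τ.Broken) (e : τ.Facet) : ℝ :=
  faceInt e fun x => - meanFlux o c μ e p x + sigma o c μ α e x * jump o e p x

theorem coupling_elemIndicator (α : τ.Facet → ℝ) (E : Finset τ.Facet) (p : τ.Broken) (T : ι) :
    coupling o c μ α E p (elemIndicator 𝒯 T) =
      ∑ e ∈ E, elemSgn o 𝒯 T e * numFlux o c μ α p e := by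
  refine Finset.sum_congr rfl fun e _ => ?_
  rw [numFlux, faceInt, faceInt, ← integral_const_mul]
  congr 1
  ext1 x
  rw [meanFlux_elemIndicator, jump_elemIndicator]
  ring

theorem res_elemIndicator_self (T : ι) : 𝒯.res T (elemIndicator 𝒯 T) = fun _ => 1 := by
  ext1 t
  simp [CoarsePartition.res, elemIndicator, t.2]

theorem res_elemIndicator_of_ne {T S : ι} (h : S ≠ T) : 𝒯.res S (elemIndicator 𝒯 T) = 0 := by
  ext1 t
  simp [CoarsePartition.res, elemIndicator, t.2, h]

theorem formBh_elemIndicator [Fintype ι] (b : LocalForms P 𝒯) (α : τ.Facet → ℝ)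
    (p : τ.Broken) (T : ι) :
    formBh o c μ b α p (elemIndicator 𝒯 T) =
      b μ T (𝒯.res T p) (fun _ => 1) + ∑ e, elemSgn o 𝒯 T e * numFlux o c μ α p e := by
  rw [formBh]
  congr 1
  · rw [Finset.sum_eq_single T, res_elemIndicator_self]
    · intro S _ hS
      rw [res_elemIndicator_of_ne hS, map_zero]
    · exact fun h => absurd (Finset.mem_univ T) h
  · simp only [coupling_elemIndicator]
    exact sum_coarseFaces o fun e he => by rw [elemSgn_eq_zero o he, zero_mul]

theorem formL_elemIndicator [Fintype ι] {f : Pt (n + 1) → ℝ}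
    (hf : MemLp f 2 (volume.restrict Ω)) (T : ι) :
    formL 𝒯 f (elemIndicator 𝒯 T) = ∫ x in 𝒯.region T, f x := by
  rw [formL, setIntegral_region 𝒯 T (integrableOn_cellSet hf), Finset.sum_eq_single T]
  · refine Finset.sum_congr rfl fun t _ => ?_
    simp [elemIndicator, t.2]
  · intro S _ hS
    refine Finset.sum_eq_zero fun t _ => ?_
    simp [elemIndicator, t.2, hS]
  · exact fun h => absurd (Finset.mem_univ T) h

theorem memBroken_elemIndicator {W : (T : ι) → Submodule ℝ (𝒯.LocalBroken T)} {T : ι}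
    (h1 : (fun _ => 1) ∈ W T) : MemBroken W (elemIndicator 𝒯 T) := by
  intro S
  by_cases hS : S = T
  · subst hS
    rwa [res_elemIndicator_self]
  · rw [res_elemIndicator_of_ne hS]
    exact Submodule.zero_mem _

variable {o c μ} {b : LocalForms P 𝒯} {α : τ.Facet → ℝ} {S : LocalSpaces 𝒯} {k l : ℕ}
  {p : τ.Broken} {u : τ.Cell → Fin (n + 1) → RPoly (n + 1)}

theorem IsFluxReconstruction.localForm_one [Fintype ι]
    (hu : IsFluxReconstruction o c μ b α S k l p u) {T : ι}
    (h1 : (fun _ => 1) ∈ S.V k T) : b μ T (𝒯.res T p) (fun _ => 1) = 0 := by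
  have h := hu.volume T _ h1 fun t i => Or.inl (by simp)
  have h2 : ∀ e (t : τ.Cell) (x : Pt (n + 1)), normalFlux o c μ e t 1 x = 0 := fun e t x =>
    normalFlux_eq_zero o c μ e t (fun i => by simp) x
  simp only [h2] at h
  simpa [faceInt] using h

theorem IsFluxReconstruction.faceInt_normalTrace [Fintype ι]
    (hu : IsFluxReconstruction o c μ b α S k l p u)
    {e : τ.Facet} {t : τ.Cell} (ht : t ∈ adj e) {E : Finset τ.Facet}
    (hE : E ∈ 𝒯.facesOf (𝒯.elem t)) (he : e ∈ E) :
    faceInt e (normalTrace o u e t) = numFlux o c μ α p e := by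
  have h := hu.face _ E hE e he t ht rfl 1 (by simp)
  simpa [numFlux] using h

/-- The total divergence of `u` over `T` is the numerical flux of `p` through `∂T`: the normal
traces on fine faces interior to `T` cancel, and those on its coarse faces are prescribed. -/
theorem setIntegral_region_weakDiv_eq_sum_numFlux [Fintype ι]
    (hu : IsFluxReconstruction o c μ b α S k l p u) {w : Pt (n + 1) → ℝ}
    (hw2 : MemLp w 2 (volume.restrict Ω)) (hw : IsWeakDiv Ω (field u) w) (T : ι) :
    ∫ x in 𝒯.region T, w x = ∑ e, elemSgn o 𝒯 T e * numFlux o c μ α p e := by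
  rw [setIntegral_region_weakDiv o 𝒯 hw2 hw T,
    Finset.sum_comm' (t' := Finset.univ) (s' := fun e => {t : 𝒯.Sub T | t.1 ∈ adj e}) (by simp)]
  refine Finset.sum_congr rfl fun e _ => ?_
  have hsub : ∑ t : 𝒯.Sub T with t.1 ∈ adj e, sgn o e t.1 * faceInt e (normalTrace o u e t.1) =
      ∑ t ∈ adj e with 𝒯.elem t = T, sgn o e t * faceInt e (normalTrace o u e t) := by
    refine Finset.sum_bij (fun t _ => t.1) (fun t ht => ?_) (fun _ _ _ _ h => Subtype.ext h)
      (fun t ht => ?_) fun _ _ => rfl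
    · exact Finset.mem_filter.2 ⟨(Finset.mem_filter.1 ht).2, t.2⟩
    · obtain ⟨h1, h2⟩ := Finset.mem_filter.1 ht
      exact ⟨⟨t, h2⟩, Finset.mem_filter.2 ⟨Finset.mem_univ _, h1⟩, rfl⟩
  rw [hsub]
  by_cases hpair : ∃ t ∈ adj e, ∃ s ∈ adj e, t ≠ s ∧ 𝒯.elem t = T ∧ 𝒯.elem s = T
  · obtain ⟨t, ht, s, hs, hts, htT, hsT⟩ := hpair
    rw [elemSgn, filter_adj_eq_pair o ht hs hts htT hsT, Finset.sum_pair hts, Finset.sum_pair hts,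
      faceInt_normalTrace_eq o hw2 hw ht hs hts, ← add_mul, sgn_add_sgn ht hs hts, zero_mul,
      zero_mul]
  · rw [elemSgn, Finset.sum_mul]
    refine Finset.sum_congr rfl fun t ht => ?_
    obtain ⟨h1, rfl⟩ := Finset.mem_filter.1 ht
    rcases exists_coarseFace_or (𝒯 := 𝒯) h1 with ⟨E, hE, heE⟩ | ⟨s, hs, hts, hsT⟩
    · rw [hu.faceInt_normalTrace h1 hE heE]
    · exact absurd ⟨t, h1, s, hs, hts, rfl, hsT⟩ hpair

end Coarse

theorem IsGalerkin.locallyConservative {n : ℕ} {Ω : Set (Pt (n + 1))} {τ : Triangulation (n + 1) Ω}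
    {o : FaceOrientation τ} {ι : Type} [Fintype ι] {𝒯 : CoarsePartition τ ι} {m : ℕ}
    {P : Set (EuclideanSpace ℝ (Fin m))} {c : Coefficients τ P} {μ : P} {f : Pt (n + 1) → ℝ}
    (hf : MemLp f 2 (volume.restrict Ω)) {α : τ.Facet → ℝ} {S : LocalSpaces 𝒯}
    {b : LocalForms P 𝒯} {k l : ℕ} {W : (T : ι) → Submodule ℝ (𝒯.LocalBroken T)}
    {p : τ.Broken} (hp : IsGalerkin o c μ b α f W p) (hW : ∀ T, W T ≤ S.V k T)
    (hone : ∀ T, (fun _ => 1) ∈ W T) {u : τ.Cell → Fin (n + 1) → RPoly (n + 1)}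
    (hu : IsFluxReconstruction o c μ b α S k l p u) : LocallyConservative 𝒯 f (field u) := by
  refine ⟨hu.mem.1, fun w hw2 hw T => ?_⟩
  have h1 := hp.2 _ (memBroken_elemIndicator (hone T))
  rw [formBh_elemIndicator, hu.localForm_one (hW T (hone T)), zero_add,
    formL_elemIndicator hf] at h1
  rw [setIntegral_region_weakDiv_eq_sum_numFlux hu hw2 hw T, h1]

end LRBMS

end

open LRBMS
theorem lemma2 (d : ℕ) (hd : d = 2 ∨ d = 3)
    (Ω : Set (Pt d)) (hΩo : IsOpen Ω) (hΩc : IsConnected Ω)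
    (τ : Triangulation d Ω) (o : FaceOrientation τ)
    (ι : Type) [Fintype ι] (𝒯 : CoarsePartition τ ι)
    (m : ℕ) (P : Set (EuclideanSpace ℝ (Fin m))) (c : Coefficients τ P) (μ : P)
    (f : Pt d → ℝ) (hf : MemLp f 2 (volume.restrict Ω))
    (α : τ.Facet → ℝ) (hα : ∀ e, 0 < α e)
    (S : LocalSpaces 𝒯) (b : LocalForms P 𝒯)
    (k l : ℕ) (hk : 1 ≤ k) (hkl : k - 1 ≤ l) (hlk : l ≤ k)
    (Vred : (T : ι) → Submodule ℝ (𝒯.LocalBroken T))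
    (p : τ.Broken)
    (hp : (IsMultiscaleDG o c μ b α f S p ∧ ∀ T, (fun _ => 1) ∈ S.V 1 T) ∨
      (IsLRBMS o c μ b α f S k Vred p ∧ ∀ T, (fun _ => 1) ∈ Vred T))
    (u : τ.Cell → Fin d → RPoly d)
    (hu : IsFluxReconstruction o c μ b α S k l p u) :
    LocallyConservative 𝒯 f (field u) := by
  obtain ⟨n, rfl⟩ : ∃ n, d = n + 1 := ⟨d - 1, by omega⟩
  rcases hp with ⟨hp, hone⟩ | ⟨⟨hsub, hp⟩, hone⟩
  · exact IsGalerkin.locallyConservative hf hp (S.mono 1 k le_rfl hk) hone hu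
  · exact IsGalerkin.locallyConservative hf hp hsub hone hu
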